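/- **Improved Bochner inequality.** Let $M$ be a connected $n$-dimensional $C^\infty$-manifold without boundary, $n\ge 2$, let $\mathfrak m$ be a positive $C^\infty$-measure on $M$ (in every chart $d\mathfrak m=e^{\Phi}\,dx^1\cdots dx^n$ with $\Phi$ smooth), and let $F:TM\to[0,\infty)$ be a $C^\infty$-Finsler structure: $F$ is $C^\infty$ on $TM\setminus 0$, $F(cv)=cF(v)$ for all $c\ge 0$, and $g_{ij}(v)=\frac12\frac{\partial^2(F^2)}{\partial v^i\partial v^j}(v)$ is positive definite for $v\ne0$ ($F$ is not assumed reversible). Write $(g^{ij})$ for the inverse matrix of $(g_{ij})$. For $u:M\to\mathbb R$ differentiable, let $\boldsymbol\nabla u(x)\in T_xM$ be the Legendre transform of $Du(x)$, i.e. the unique $v\in T_xM$ with $F(v)=F^*(Du(x))$ and $Du(x)(v)=F^*(Du(x))^2$, where $F^*(\alpha)=\sup\{\alpha(w): w\in T_xM,\ F(w)\le1\}$. For a vector field $V$ let $\operatorname{div}_{\mathfrak m}V=\sum_i\big(\frac{\partial V^i}{\partial x^i}+V^i\frac{\partial\Phi}{\partial x^i}\big)$, and put $\boldsymbol\Delta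 u=\operatorname{div}_{\mathfrak m}(\boldsymbol\nabla u)$, $\nabla^{V}f=\sum_{i,j}g^{ij}(V)\frac{\partial f}{\partial x^j}\frac{\partial}{\partial x^i}$ and $\Delta^{V}f=\operatorname{div}_{\mathfrak m}(\nabla^{V}f)$ where $V\neq0$. Let $\gamma^i_{jk}=\frac12\sum_l g^{il}\big(\frac{\partial g_{lk}}{\partial x^j}+\frac{\partial g_{jl}}{\partial x^k}-\frac{\partial g_{jk}}{\partial x^l}\big)$, $G^i(v)=\sum_{j,k}\gamma^i_{jk}(v)v^jv^k$ and $N^i_j=\frac12\frac{\partial G^i}{\partial v^j}$. The Finsler Ricci curvature of $v\in TM\setminus 0$ is the trace $\mathrm{Ric}(v)=\sum_i R^i_i(v)$ of the Riemann (flag) curvature $$R^i_k=\frac{\partial G^i}{\partial x^k}-\sum_j v^j\frac{\partial N^i_k}{\partial x^j}+\sum_j G^j\frac{\partial N^i_k}{\partial v^j}-\sum_j N^i_jN^j_k .$$ For $v\in T_xM\setminus0$ let $\eta$ be the geodesic ($\ddot\eta^i+G^i(\dot\eta)=0$) with $\dot\eta(0)=v$, and let $\Psi$ be the function along $\eta$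 with $\mathfrak m=e^{-\Psi}\mathrm{vol}_{g_{\dot\eta}}$, i.e. $e^{\Phi(\eta)}=e^{-\Psi}\sqrt{\det (g_{ij}(\dot\eta))}$; set $\mathrm{Ric}_\infty(v)=\mathrm{Ric}(v)+(\Psi\circ\eta)''(0)$ and $\mathrm{Ric}_\infty(0)=0$. The condition $\mathrm{Ric}_\infty\ge K$ means $\mathrm{Ric}_\infty(v)\ge K F^2(v)$ for all $v\in TM$. **Claim.** If $\mathrm{Ric}_\infty\ge K$ for some $K\in\mathbb R$, then for every $u\in C^\infty(M)$ and at every point of $M_u=\{x\in M: Du(x)\ne0\}$, $$\Delta^{\boldsymbol\nabla u}\Big[\frac{F^2(\boldsymbol\nabla u)}2\Big]-D[\boldsymbol\Delta u](\boldsymbol\nabla u)-K F^2(\boldsymbol\nabla u)\ \ge\ D[F(\boldsymbol\nabla u)]\big(\nabla^{\boldsymbol\nabla u}[F(\boldsymbol\nabla u)]\big).$$ -/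

import Mathlib

open scoped Manifold ContDiff

noncomputable section

namespace Finsler

/-- The model space `ℝⁿ`. -/
abbrev Model (n : ℕ) : Type := EuclideanSpace ℝ (Fin n)

/-- The coordinate vector `∂/∂xⁱ` of `ℝⁿ`. -/
def basisVec {n : ℕ} (i : Fin n) : Model n := EuclideanSpace.single i 1

/-- `½ D²(f²)(v)[a, b]`, the Hessian of `f² / 2` at `v` evaluated on `a, b`. -/
def halfHess {n : ℕ} (f : Model n → ℝ) (v a b : Model n) : ℝ :=
  (1 / 2) * fderiv ℝ (fun w => fderiv ℝ (fun z => f z ^ 2) w b) v a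

/-- The matrix `g_{ij}(v) = ½ ∂²(f²)/∂vⁱ∂vʲ (v)`. -/
def gMatrix {n : ℕ} (f : Model n → ℝ) (v : Model n) : Matrix (Fin n) (Fin n) ℝ :=
  Matrix.of fun i j => halfHess f v (basisVec i) (basisVec j)

/-! ### Coordinate expressions

Here `f x v` is the coordinate expression of a Finsler structure in the fibre-wise linear
coordinates `(xⁱ, vʲ)` of the tangent bundle over a chart domain. -/

section Coordinates

variable {n : ℕ}

/-- `∂H/∂xⁱ (x, v)`. -/
def pdx (i : Fin n) (H : Model n → Model n → ℝ) (x v : Model n) : ℝ :=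
  fderiv ℝ (fun y => H y v) x (basisVec i)

/-- `∂H/∂vⁱ (x, v)`. -/
def pdv (i : Fin n) (H : Model n → Model n → ℝ) (x v : Model n) : ℝ :=
  fderiv ℝ (fun w => H x w) v (basisVec i)

/-- `g_{ij}(x, v)`. -/
def gLow (f : Model n → Model n → ℝ) (i j : Fin n) (x v : Model n) : ℝ :=
  gMatrix (f x) v i j

/-- `g^{ij}(x, v)`, the inverse matrix. -/
def gUp (f : Model n → Model n → ℝ) (i j : Fin n) (x v : Model n) : ℝ :=
  (gMatrix (f x) v)⁻¹ i j

/-- The formal Christoffel symbols `γⁱ_{jk}(x, v)`. -/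
def formalChristoffel (f : Model n → Model n → ℝ) (i j k : Fin n) (x v : Model n) : ℝ :=
  (1 / 2) * ∑ l, gUp f i l x v *
    (pdx j (gLow f l k) x v + pdx k (gLow f j l) x v - pdx l (gLow f j k) x v)

/-- The geodesic spray coefficients `Gⁱ = ∑ γⁱ_{jk} vʲ vᵏ`. -/
def spray (f : Model n → Model n → ℝ) (i : Fin n) (x v : Model n) : ℝ :=
  ∑ j, ∑ k, formalChristoffel f i j k x v * v j * v k

/-- The nonlinear connection `Nⁱ_j = ½ ∂Gⁱ/∂vʲ`. -/
def nonlinConn (f : Model n → Model n → ℝ) (i j : Fin n) (x v : Model n) : ℝ :=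
  (1 / 2) * pdv j (spray f i) x v

/-- The Riemann (flag) curvature
`Rⁱ_k = ∂Gⁱ/∂xᵏ - ∑ vʲ ∂Nⁱ_k/∂xʲ + ∑ Gʲ ∂Nⁱ_k/∂vʲ - ∑ Nⁱ_j Nʲ_k`; the flag curvature of the
flag spanned by `v, w` is `g_v(R_v w, w) / (g_v(v, v) g_v(w, w) - g_v(v, w)²)`. -/
def riemannCurv (f : Model n → Model n → ℝ) (i k : Fin n) (x v : Model n) : ℝ :=
  pdx k (spray f i) x v
    - ∑ j, v j * pdx j (nonlinConn f i k) x v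
    + ∑ j, spray f j x v * pdv j (nonlinConn f i k) x v
    - ∑ j, nonlinConn f i j x v * nonlinConn f j k x v

/-- The Ricci curvature `Ric(v) = ∑ Rⁱ_i(v)`, the trace of the flag curvature. -/
def ricciCoord (f : Model n → Model n → ℝ) (x v : Model n) : ℝ :=
  ∑ i, riemannCurv f i i x v

/-- The function `Ψ` with `e^{Φ} dx = e^{-Ψ} √det g_{ij}(v) dx`: the measure with density `e^{Φ}`
is `e^{-Ψ} vol_{g_V}` at a point `x` where the vector field `V` takes the value `v`. -/
def weightCoord (f : Model n → Model n → ℝ) (Φ : Model n → ℝ) (x v : Model n) : ℝ :=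
  Real.log (Real.sqrt (gMatrix (f x) v).det) - Φ x

end Coordinates

/-! ### Finsler manifolds -/

/-- A `C^∞` Finsler structure on `M`. -/
structure FinslerStructure (n : ℕ) (M : Type*) [TopologicalSpace M]
    [ChartedSpace (Model n) M] [IsManifold (𝓡 n) ∞ M] where
  /-- The function `F` on the tangent bundle. -/
  toFun : (x : M) → TangentSpace (𝓡 n) x → ℝ
  nonneg : ∀ x v, 0 ≤ toFun x v
  /-- Smooth away from the zero section. -/
  smooth : ContMDiffOn (𝓡 n).tangent 𝓘(ℝ, ℝ) ∞
    (fun p : TangentBundle (𝓡 n) M => toFun p.1 p.2) {p | p.2 ≠ 0}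
  /-- Positive 1-homogeneity. -/
  homogeneous : ∀ (x : M) (v : TangentSpace (𝓡 n) x) (c : ℝ), 0 ≤ c →
    toFun x (c • v) = c * toFun x v
  /-- Strong convexity: `g_v` is positive definite for `v ≠ 0`. -/
  stronglyConvex : ∀ (x : M) (v w : TangentSpace (𝓡 n) x), v ≠ 0 → w ≠ 0 →
    0 < halfHess (n := n) (toFun x) v w w

section Manifold

variable {n : ℕ} {M : Type*} [TopologicalSpace M] [ChartedSpace (Model n) M]
  [IsManifold (𝓡 n) ∞ M]

/-- The coordinate expression of `F` in the chart `e`. -/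
def FinslerStructure.inChart (F : FinslerStructure n M) (e : OpenPartialHomeomorph M (Model n))
    (y w : Model n) : ℝ :=
  F.toFun (e.symm y) (mfderiv 𝓘(ℝ, Model n) (𝓡 n) e.symm y w)

/-- The coordinates in the chart `e` of a tangent vector `v` at `x`. -/
def vecInChart (e : OpenPartialHomeomorph M (Model n)) (x : M) (v : TangentSpace (𝓡 n) x) :
    Model n :=
  mfderiv (𝓡 n) 𝓘(ℝ, Model n) e x v

/-- The differential `Du(x)` of a function. -/
def differential (u : M → ℝ) (x : M) : TangentSpace (𝓡 n) x →L[ℝ] ℝ :=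
  mfderiv (𝓡 n) 𝓘(ℝ, ℝ) u x

/-! #### Smooth positive measures and divergence -/

/-- In the chart `e`, the measure `m` is `e^{Φ} dx¹ ⋯ dxⁿ` with `Φ` smooth. -/
def IsLogDensity [MeasurableSpace M] (m : MeasureTheory.Measure M)
    (e : OpenPartialHomeomorph M (Model n)) (Φ : Model n → ℝ) : Prop :=
  ContDiffOn ℝ ∞ Φ e.target ∧
    ∀ s : Set M, MeasurableSet s → s ⊆ e.source →
      m s = ∫⁻ y in e '' s, ENNReal.ofReal (Real.exp (Φ y))

/-- `m` is a positive `C^∞` measure. -/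
def IsSmoothPositiveMeasure (n : ℕ) {M : Type*} [TopologicalSpace M] [ChartedSpace (Model n) M]
    [MeasurableSpace M] (m : MeasureTheory.Measure M) : Prop :=
  ∀ e ∈ atlas (Model n) M, ∃ Φ : Model n → ℝ, IsLogDensity m e Φ

/-- The function `Φ` with `m = e^{Φ} dx¹ ⋯ dxⁿ` in the chart `e` (unique on `e.target`). -/
def logDensity [MeasurableSpace M] (m : MeasureTheory.Measure M)
    (e : OpenPartialHomeomorph M (Model n)) : Model n → ℝ :=
  Classical.epsilon (IsLogDensity m e)

/-- `div_m V = ∑ᵢ (∂Vⁱ/∂xⁱ + Vⁱ ∂Φ/∂xⁱ)`, at `x` in the preferred chart at `x`. -/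
def divergence [MeasurableSpace M] (m : MeasureTheory.Measure M)
    (V : (x : M) → TangentSpace (𝓡 n) x) (x : M) : ℝ :=
  let e := chartAt (Model n) x
  let W : Model n → Model n := fun y => vecInChart e (e.symm y) (V (e.symm y))
  ∑ i : Fin n, (fderiv ℝ (fun y => W y i) (e x) (basisVec i)
    + W (e x) i * fderiv ℝ (logDensity m e) (e x) (basisVec i))

/-! #### Gradient and Laplacian -/

/-- The dual norm `F*(α) = sup {α(v) : F(v) ≤ 1}`. -/
def FinslerStructure.dualNorm (F : FinslerStructure n M) (x : M)
    (α : TangentSpace (𝓡 n) x →L[ℝ] ℝ) : ℝ :=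
  sSup {r : ℝ | ∃ v : TangentSpace (𝓡 n) x, F.toFun x v ≤ 1 ∧ r = α v}

/-- The Legendre transform: the unique `v` with `F(v) = F*(α)` and `α(v) = F*(α)²`. -/
def FinslerStructure.legendre (F : FinslerStructure n M) (x : M)
    (α : TangentSpace (𝓡 n) x →L[ℝ] ℝ) : TangentSpace (𝓡 n) x :=
  Classical.epsilon fun v : TangentSpace (𝓡 n) x =>
    F.toFun x v = F.dualNorm x α ∧ α v = F.dualNorm x α ^ 2

/-- The (nonlinear) gradient vector field `∇u`. -/
def FinslerStructure.gradient (F : FinslerStructure n M) (u : M → ℝ) (x : M) :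
    TangentSpace (𝓡 n) x :=
  F.legendre x (differential u x)

/-- The (nonlinear) Laplacian `Δu = div_m(∇u)`. -/
def FinslerStructure.laplacian [MeasurableSpace M] (F : FinslerStructure n M)
    (m : MeasureTheory.Measure M) (u : M → ℝ) : M → ℝ :=
  divergence m (F.gradient u)

/-- The linearized gradient `∇^V f = ∑ g^{ij}(V) ∂f/∂xʲ ∂/∂xⁱ`, i.e. the gradient of `f` with
respect to the Riemannian metric `g_V`; at `x` in the coordinates of the preferred chart at `x`,
in which `TangentSpace (𝓡 n) x` is `ℝⁿ`. -/
def FinslerStructure.linGradient (F : FinslerStructure n M)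
    (V : (x : M) → TangentSpace (𝓡 n) x) (f : M → ℝ) (x : M) : TangentSpace (𝓡 n) x :=
  ∑ i : Fin n, (∑ j : Fin n, (gMatrix (n := n) (F.toFun x) (V x))⁻¹ i j
    * differential f x (basisVec j : Model n)) • (basisVec i : Model n)

/-- The linearized Laplacian `Δ^V f = div_m(∇^V f)`. -/
def FinslerStructure.linLaplacian [MeasurableSpace M] (F : FinslerStructure n M)
    (m : MeasureTheory.Measure M) (V : (x : M) → TangentSpace (𝓡 n) x) (f : M → ℝ) : M → ℝ :=
  divergence m (F.linGradient V f)

/-! #### Weighted Ricci curvature -/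

/-- Near `t = 0`, the curve `η` is the geodesic with initial velocity `v` at `x`: in the preferred
chart at `x` it solves the geodesic equation `η̈ⁱ + Gⁱ(η̇) = 0`. -/
structure FinslerStructure.IsGeodesicAt (F : FinslerStructure n M) (x : M)
    (v : TangentSpace (𝓡 n) x) (η : ℝ → M) : Prop where
  start : η 0 = x
  mem_source : ∀ᶠ t in nhds (0 : ℝ), η t ∈ (chartAt (Model n) x).source
  velocity : HasDerivAt (fun s => chartAt (Model n) x (η s)) (vecInChart (chartAt (Model n) x) x v) 0
  differentiable : ∀ᶠ t in nhds (0 : ℝ),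
    DifferentiableAt ℝ (fun s => chartAt (Model n) x (η s)) t
  equation : ∀ᶠ t in nhds (0 : ℝ), ∀ i : Fin n,
    HasDerivAt (fun s => deriv (fun r => chartAt (Model n) x (η r)) s i)
      (-spray (F.inChart (chartAt (Model n) x)) i (chartAt (Model n) x (η t))
        (deriv (fun r => chartAt (Model n) x (η r)) t)) t

/-- The geodesic `η` with `η̇(0) = v` (its germ at `0` is unique for `v ≠ 0`). -/
def FinslerStructure.geodesic (F : FinslerStructure n M) (x : M) (v : TangentSpace (𝓡 n) x) :
    ℝ → M :=
  haveI : Nonempty M := ⟨x⟩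
  Classical.epsilon (F.IsGeodesicAt x v)

/-- The Ricci curvature `Ric(v)` of `F`, for `v ≠ 0`. -/
def FinslerStructure.ricci (F : FinslerStructure n M) (x : M) (v : TangentSpace (𝓡 n) x) : ℝ :=
  ricciCoord (F.inChart (chartAt (Model n) x)) (chartAt (Model n) x x)
    (vecInChart (chartAt (Model n) x) x v)

/-- `Ψ ∘ η` for a curve `η` in the chart domain at `x`, where `m = e^{-Ψ} vol_{g_V}` and `V` is a
vector field extending the velocity of `η`, i.e. `V(η(t)) = η̇(t)`. -/
def FinslerStructure.weightAlong [MeasurableSpace M] (F : FinslerStructure n M)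
    (m : MeasureTheory.Measure M) (x : M) (η : ℝ → M) (t : ℝ) : ℝ :=
  weightCoord (F.inChart (chartAt (Model n) x)) (logDensity m (chartAt (Model n) x))
    (chartAt (Model n) x (η t)) (deriv (fun s => chartAt (Model n) x (η s)) t)

/-- The weighted Ricci curvature `Ric_∞(v) = Ric(v) + (Ψ ∘ η)''(0)`, with `η` the geodesic with
`η̇(0) = v`, and `Ric_∞(0) = 0`. Both terms are positively 2-homogeneous in `v`, so no
normalization `F(v) = 1` is needed. -/
def FinslerStructure.ricciInfty [MeasurableSpace M] (F : FinslerStructure n M)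
    (m : MeasureTheory.Measure M) (x : M) (v : TangentSpace (𝓡 n) x) : ℝ :=
  open Classical in
  if v = 0 then 0
  else F.ricci x v + deriv (deriv (F.weightAlong m x (F.geodesic x v))) 0

/-- The condition `Ric_∞ ≥ K`. -/
def FinslerStructure.RicciInftyGE [MeasurableSpace M] (F : FinslerStructure n M)
    (m : MeasureTheory.Measure M) (K : ℝ) : Prop :=
  ∀ (x : M) (v : TangentSpace (𝓡 n) x), K * F.toFun x v ^ 2 ≤ F.ricciInfty m x v

end Manifold

end Finsler

end

noncomputable section

namespace Finsler

section

variable {n : ℕ}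

/-! ### Coordinate vectors -/

/-! Fix a chart around `x` and let `W` be the gradient field of `u` there, on the open set where `Du
≠ 0`. Put `A = (∂Wⁱ/∂xʲ + Nⁱ_j(W))`, the covariant derivative of `W` with reference vector `W`, and
let `g = g_W`. The proof combines an identity and a Cauchy–Schwarz estimate.

The identity `coordDiv_accel_sub` is `div(A W) - D(div W)(W) = tr(A²) + Ric(W) + (weight term)`. It
holds for every nowhere vanishing smooth field and is a cancellation of coordinate expressions once
`N v = G` is known (`sum_nonlinConn_mul_coord`). The weight term is `sprayDeriv` of `weightFlow`,
that is, the second derivative of `Ψ` along the geodesic with initial velocity `W`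
(`deriv_deriv_weightAlong`). The integral curves of `W` need not be geodesics, so the identity uses
the pointwise geodesic derivative `sprayDeriv`. The two curvature terms add up to `Ric_∞(W) ≥ K
F²(W)`.

That `W` is a gradient enters twice: `g A` is symmetric (`gMatrix_mul_covDeriv_symm`), and `A W` is
the `g`-gradient of `F²(W)/2` (`halfHess_accel`). So `div(A W)` is the linearized Laplacian of the
energy. With `Y` the `g`-gradient of `F(W)` one has `A W = F(W) Y`, whence `F² g(Y, Y) = g(AW, AW) ≤
tr(A²) g(W, W) = tr(A²) F²`. The inequality in the middle bounds the operator norm of a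
`g`-symmetric endomorphism by its Hilbert–Schmidt norm (`mulVec_form_le_trace`). Dividing by `F² >
0` shows that `tr(A²)` dominates `g(Y, Y)`, the right-hand side of the claim
(`fderiv_norm_le_trace`).

All facts about `N` come from one source: the `v`-derivative of the Euler–Lagrange equation
(`sprayDeriv_gLow_aux`). Its symmetric part says that `g` is parallel along the geodesic flow, its
antisymmetric part makes Hessians symmetric. The remaining work is to pass to the chart: `W` is
smooth by the implicit function theorem (`contDiffOn_of_momentum_eq`), and the divergence, defined
at each point in that point's own preferred chart, can be computed in one fixed chart
(`divergence_eq_coordDiv`). -/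

theorem basisVec_apply (i j : Fin n) : (basisVec i : Model n) j = if j = i then 1 else 0 := by
  simp [basisVec]

theorem eq_sum_basisVec (a : Model n) : a = ∑ i, a i • (basisVec i : Model n) := by
  ext j
  simp [basisVec_apply]

theorem map_eq_sum_basisVec (l : Model n →L[ℝ] ℝ) (a : Model n) :
    l a = ∑ i, a i * l (basisVec i) := by
  conv_lhs => rw [eq_sum_basisVec a]
  simp

theorem clm_ext_basisVec {l l' : Model n →L[ℝ] ℝ} (h : ∀ i, l (basisVec i) = l' (basisVec i)) :
    l = l' := by
  ext a
  rw [map_eq_sum_basisVec l, map_eq_sum_basisVec l']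
  simp [h]

/-! ### Calculus of smooth functions of position and velocity -/

/-- `H` is a smooth function of `(x, v)` on `Ω`. -/
def SmoothOn (Ω : Set (Model n × Model n)) (H : Model n → Model n → ℝ) : Prop :=
  ContDiffOn ℝ ∞ (fun q : Model n × Model n => H q.1 q.2) Ω

variable {Ω : Set (Model n × Model n)} {H H' : Model n → Model n → ℝ} {x v : Model n}

theorem SmoothOn.differentiableAt (hH : SmoothOn Ω H) (hΩ : IsOpen Ω) (h : (x, v) ∈ Ω) :
    DifferentiableAt ℝ (fun q : Model n × Model n => H q.1 q.2) (x, v) :=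
  (hH.contDiffAt (hΩ.mem_nhds h)).differentiableAt (by simp)

theorem SmoothOn.hasFDerivAt_fst (hH : SmoothOn Ω H) (hΩ : IsOpen Ω) (h : (x, v) ∈ Ω) :
    HasFDerivAt (fun y => H y v) ((fderiv ℝ (fun q : Model n × Model n => H q.1 q.2) (x, v)).comp
      (ContinuousLinearMap.inl ℝ (Model n) (Model n))) x := by
  have h1 := (hH.differentiableAt hΩ h).hasFDerivAt
  exact HasFDerivAt.comp (g := fun q : Model n × Model n => H q.1 q.2) (f := fun y => (y, v)) x h1
    (hasFDerivAt_prodMk_left x v)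

theorem SmoothOn.hasFDerivAt_snd (hH : SmoothOn Ω H) (hΩ : IsOpen Ω) (h : (x, v) ∈ Ω) :
    HasFDerivAt (fun w => H x w) ((fderiv ℝ (fun q : Model n × Model n => H q.1 q.2) (x, v)).comp
      (ContinuousLinearMap.inr ℝ (Model n) (Model n))) v := by
  have h1 := (hH.differentiableAt hΩ h).hasFDerivAt
  exact HasFDerivAt.comp (g := fun q : Model n × Model n => H q.1 q.2) (f := fun w => (x, w)) v h1
    (hasFDerivAt_prodMk_right x v)

theorem pdx_eq (hH : SmoothOn Ω H) (hΩ : IsOpen Ω) (h : (x, v) ∈ Ω) (i : Fin n) :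
    pdx i H x v = fderiv ℝ (fun q : Model n × Model n => H q.1 q.2) (x, v) (basisVec i, 0) := by
  simp [pdx, (hH.hasFDerivAt_fst hΩ h).fderiv]

theorem pdv_eq (hH : SmoothOn Ω H) (hΩ : IsOpen Ω) (h : (x, v) ∈ Ω) (i : Fin n) :
    pdv i H x v = fderiv ℝ (fun q : Model n × Model n => H q.1 q.2) (x, v) (0, basisVec i) := by
  simp [pdv, (hH.hasFDerivAt_snd hΩ h).fderiv]

theorem fderiv_eq_sum_pd (hH : SmoothOn Ω H) (hΩ : IsOpen Ω) (h : (x, v) ∈ Ω) (a b : Model n) :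
    fderiv ℝ (fun q : Model n × Model n => H q.1 q.2) (x, v) (a, b) =
      ∑ i, a i * pdx i H x v + ∑ i, b i * pdv i H x v := by
  have : (a, b) = (a, (0 : Model n)) + ((0 : Model n), b) := by simp
  rw [this, map_add]
  congr 1
  · simp_rw [pdx_eq hH hΩ h]
    exact map_eq_sum_basisVec ((fderiv ℝ (fun q : Model n × Model n => H q.1 q.2) (x, v)).comp
      (ContinuousLinearMap.inl ℝ (Model n) (Model n))) a
  · simp_rw [pdv_eq hH hΩ h]
    exact map_eq_sum_basisVec ((fderiv ℝ (fun q : Model n × Model n => H q.1 q.2) (x, v)).comp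
      (ContinuousLinearMap.inr ℝ (Model n) (Model n))) b

theorem SmoothOn.fderiv_apply (hH : SmoothOn Ω H) (hΩ : IsOpen Ω) (a : Model n × Model n) :
    ContDiffOn ℝ ∞
      (fun q => fderiv ℝ (fun q : Model n × Model n => H q.1 q.2) q a) Ω :=
  (hH.fderiv_of_isOpen hΩ (by simp)).clm_apply contDiffOn_const

theorem SmoothOn.congr (hH : SmoothOn Ω H) (h : ∀ x v, (x, v) ∈ Ω → H' x v = H x v) :
    SmoothOn Ω H' :=
  ContDiffOn.congr hH fun q hq => h q.1 q.2 hq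

theorem SmoothOn.pdx (hH : SmoothOn Ω H) (hΩ : IsOpen Ω) (i : Fin n) : SmoothOn Ω (pdx i H) :=
  ContDiffOn.congr (hH.fderiv_apply hΩ (basisVec i, 0)) fun _ hq => pdx_eq hH hΩ hq i

theorem SmoothOn.pdv (hH : SmoothOn Ω H) (hΩ : IsOpen Ω) (i : Fin n) : SmoothOn Ω (pdv i H) :=
  ContDiffOn.congr (hH.fderiv_apply hΩ (0, basisVec i)) fun _ hq => pdv_eq hH hΩ hq i

theorem SmoothOn.add (hH : SmoothOn Ω H) (hH' : SmoothOn Ω H') :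
    SmoothOn Ω (fun x v => H x v + H' x v) := ContDiffOn.add hH hH'

theorem SmoothOn.sub (hH : SmoothOn Ω H) (hH' : SmoothOn Ω H') :
    SmoothOn Ω (fun x v => H x v - H' x v) := ContDiffOn.sub hH hH'

theorem SmoothOn.mul (hH : SmoothOn Ω H) (hH' : SmoothOn Ω H') :
    SmoothOn Ω (fun x v => H x v * H' x v) := ContDiffOn.mul hH hH'

theorem SmoothOn.const (c : ℝ) : SmoothOn Ω (fun _ _ => c) := contDiffOn_const

theorem SmoothOn.sum {ι : Type*} {s : Finset ι} {K : ι → Model n → Model n → ℝ}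
    (hK : ∀ i ∈ s, SmoothOn Ω (K i)) : SmoothOn Ω (fun x v => ∑ i ∈ s, K i x v) :=
  ContDiffOn.sum hK

theorem SmoothOn.prod {ι : Type*} {s : Finset ι} {K : ι → Model n → Model n → ℝ}
    (hK : ∀ i ∈ s, SmoothOn Ω (K i)) : SmoothOn Ω (fun x v => ∏ i ∈ s, K i x v) :=
  contDiffOn_prod hK

theorem SmoothOn.coord (j : Fin n) : SmoothOn Ω (fun _ v => v j) := by
  have : ContDiff ℝ ∞ (fun q : Model n × Model n => (EuclideanSpace.proj j : _ →L[ℝ] ℝ) q.2) := by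
    fun_prop
  exact this.contDiffOn

theorem pdx_congr (hΩ : IsOpen Ω) (h : ∀ x v, (x, v) ∈ Ω → H x v = H' x v) (hx : (x, v) ∈ Ω)
    (i : Fin n) : pdx i H x v = pdx i H' x v := by
  have : (fun y => H y v) =ᶠ[nhds x] fun y => H' y v := by
    have hc : ContinuousAt (fun y : Model n => (y, v)) x := by fun_prop
    filter_upwards [hc.preimage_mem_nhds (hΩ.mem_nhds hx)] with y hy using h y v hy
  simp [Finsler.pdx, this.fderiv_eq]

theorem pdv_congr (hΩ : IsOpen Ω) (h : ∀ x v, (x, v) ∈ Ω → H x v = H' x v) (hx : (x, v) ∈ Ω)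
    (i : Fin n) : pdv i H x v = pdv i H' x v := by
  have : (fun y => H x y) =ᶠ[nhds v] fun y => H' x y := by
    have hc : ContinuousAt (fun w : Model n => (x, w)) v := by fun_prop
    filter_upwards [hc.preimage_mem_nhds (hΩ.mem_nhds hx)] with y hy using h x y hy
  simp [Finsler.pdv, this.fderiv_eq]

theorem SmoothOn.differentiableAt_fst (hH : SmoothOn Ω H) (hΩ : IsOpen Ω) (h : (x, v) ∈ Ω) :
    DifferentiableAt ℝ (fun y => H y v) x := (hH.hasFDerivAt_fst hΩ h).differentiableAt

theorem SmoothOn.differentiableAt_snd (hH : SmoothOn Ω H) (hΩ : IsOpen Ω) (h : (x, v) ∈ Ω) :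
    DifferentiableAt ℝ (fun w => H x w) v := (hH.hasFDerivAt_snd hΩ h).differentiableAt

theorem pdx_sub (hΩ : IsOpen Ω) (h : (x, v) ∈ Ω) (i : Fin n)
    (hH : SmoothOn Ω H) (hH' : SmoothOn Ω H') :
    pdx i (fun x v => H x v - H' x v) x v = pdx i H x v - pdx i H' x v := by
  simp [pdx, fderiv_fun_sub (hH.differentiableAt_fst hΩ h) (hH'.differentiableAt_fst hΩ h)]

theorem pdv_sub (hΩ : IsOpen Ω) (h : (x, v) ∈ Ω) (i : Fin n)
    (hH : SmoothOn Ω H) (hH' : SmoothOn Ω H') :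
    pdv i (fun x v => H x v - H' x v) x v = pdv i H x v - pdv i H' x v := by
  simp [pdv, fderiv_fun_sub (hH.differentiableAt_snd hΩ h) (hH'.differentiableAt_snd hΩ h)]

theorem pdx_mul (hΩ : IsOpen Ω) (h : (x, v) ∈ Ω) (i : Fin n)
    (hH : SmoothOn Ω H) (hH' : SmoothOn Ω H') :
    pdx i (fun x v => H x v * H' x v) x v = pdx i H x v * H' x v + H x v * pdx i H' x v := by
  simp [pdx, fderiv_fun_mul (hH.differentiableAt_fst hΩ h) (hH'.differentiableAt_fst hΩ h)]
  ring

theorem pdv_mul (hΩ : IsOpen Ω) (h : (x, v) ∈ Ω) (i : Fin n)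
    (hH : SmoothOn Ω H) (hH' : SmoothOn Ω H') :
    pdv i (fun x v => H x v * H' x v) x v = pdv i H x v * H' x v + H x v * pdv i H' x v := by
  simp [pdv, fderiv_fun_mul (hH.differentiableAt_snd hΩ h) (hH'.differentiableAt_snd hΩ h)]
  ring

theorem pdx_sum (hΩ : IsOpen Ω) (h : (x, v) ∈ Ω) (i : Fin n)
    {ι : Type*} {s : Finset ι} {K : ι → Model n → Model n → ℝ}
    (hK : ∀ j ∈ s, SmoothOn Ω (K j)) :
    pdx i (fun x v => ∑ j ∈ s, K j x v) x v = ∑ j ∈ s, pdx i (K j) x v := by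
  simp only [pdx]
  rw [fderiv_fun_sum fun j hj => (hK j hj).differentiableAt_fst hΩ h]
  simp

theorem pdv_sum (hΩ : IsOpen Ω) (h : (x, v) ∈ Ω) (i : Fin n)
    {ι : Type*} {s : Finset ι} {K : ι → Model n → Model n → ℝ}
    (hK : ∀ j ∈ s, SmoothOn Ω (K j)) :
    pdv i (fun x v => ∑ j ∈ s, K j x v) x v = ∑ j ∈ s, pdv i (K j) x v := by
  simp only [pdv]
  rw [fderiv_fun_sum fun j hj => (hK j hj).differentiableAt_snd hΩ h]
  simp

theorem pdx_const_mul (i : Fin n) (c : ℝ) : pdx i (fun x v => c * H x v) x v = c * pdx i H x v :=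
  congrArg (fun l => l x (basisVec i)) (fderiv_const_smul_field (𝕜 := ℝ) (f := fun y => H y v) c)

theorem pdv_const_mul (i : Fin n) (c : ℝ) : pdv i (fun x v => c * H x v) x v = c * pdv i H x v :=
  congrArg (fun l => l v (basisVec i)) (fderiv_const_smul_field (𝕜 := ℝ) (f := fun w => H x w) c)

theorem pdv_coord (i j : Fin n) :
    pdv i (fun _ v : Model n => v j) x v = if j = i then 1 else 0 := by
  have : HasFDerivAt (fun w : Model n => w j) (EuclideanSpace.proj j : Model n →L[ℝ] ℝ) v :=
    (EuclideanSpace.proj j : Model n →L[ℝ] ℝ).hasFDerivAt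
  simp [pdv, this.fderiv, basisVec_apply]

theorem pdv_sum_coord_mul (hΩ : IsOpen Ω) (h : (x, v) ∈ Ω) (i : Fin n)
    {K : Fin n → Model n → Model n → ℝ} (hK : ∀ j, SmoothOn Ω (K j)) :
    pdv i (fun x v => ∑ j, v j * K j x v) x v = K i x v + ∑ j, v j * pdv i (K j) x v := by
  rw [pdv_sum hΩ h i fun j _ => (SmoothOn.coord j).mul (hK j)]
  simp_rw [pdv_mul hΩ h i (SmoothOn.coord _) (hK _), pdv_coord, Finset.sum_add_distrib]
  simp

theorem pdx_sum_coord_mul (hΩ : IsOpen Ω) (h : (x, v) ∈ Ω) (i : Fin n)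
    {K : Fin n → Model n → Model n → ℝ}
    (hK : ∀ j, SmoothOn Ω (K j)) :
    pdx i (fun x v => ∑ j, v j * K j x v) x v = ∑ j, v j * pdx i (K j) x v := by
  rw [pdx_sum hΩ h i fun j _ => (SmoothOn.coord j).mul (hK j)]
  refine Finset.sum_congr rfl fun j _ => ?_
  rw [pdx_mul hΩ h i (SmoothOn.coord _) (hK _)]
  simp [pdx]

/-- Symmetry of the second derivative is used on the product space, so that directions chosen in
either factor give the `∂v∂v` and `∂v∂x` commutation rules at once. -/
theorem fderiv_fderiv_apply_comm (hΩ : IsOpen Ω) (h : (x, v) ∈ Ω)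
    (hH : SmoothOn Ω H) (a b : Model n × Model n) :
    fderiv ℝ (fun q => fderiv ℝ (fun q : Model n × Model n => H q.1 q.2) q a) (x, v) b =
      fderiv ℝ (fun q => fderiv ℝ (fun q : Model n × Model n => H q.1 q.2) q b) (x, v) a := by
  have hc := hH.contDiffAt (hΩ.mem_nhds h)
  have hs := hc.isSymmSndFDerivAt (by simp; exact WithTop.coe_le_coe.mpr (mod_cast le_top))
  have hd : DifferentiableAt ℝ (fderiv ℝ (fun q : Model n × Model n => H q.1 q.2)) (x, v) :=
    ((hH.fderiv_of_isOpen hΩ (m := 1) (by norm_cast)).contDiffAt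
      (hΩ.mem_nhds h)).differentiableAt (by simp)
  have key : ∀ a b, fderiv ℝ (fun q => fderiv ℝ (fun q : Model n × Model n => H q.1 q.2) q a)
      (x, v) b = fderiv ℝ (fderiv ℝ (fun q : Model n × Model n => H q.1 q.2)) (x, v) b a := by
    intro a b
    rw [fderiv_clm_apply hd (differentiableAt_const a)]
    simp
  rw [key, key]
  exact hs b a

theorem pdv_pdv_comm (hΩ : IsOpen Ω) (h : (x, v) ∈ Ω) (i : Fin n)
    (hH : SmoothOn Ω H) (j : Fin n) :
    pdv i (pdv j H) x v = pdv j (pdv i H) x v := by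
  have e : ∀ j x v, (x, v) ∈ Ω → pdv j H x v =
      fderiv ℝ (fun q : Model n × Model n => H q.1 q.2) (x, v) (0, basisVec j) :=
    fun j x v hx => pdv_eq hH hΩ hx j
  rw [pdv_congr hΩ (e j) h, pdv_congr hΩ (e i) h, 
    pdv_eq (H := fun x v => fderiv ℝ (fun q : Model n × Model n => H q.1 q.2) (x, v) _)
      (hH.fderiv_apply hΩ _) hΩ h,
    pdv_eq (H := fun x v => fderiv ℝ (fun q : Model n × Model n => H q.1 q.2) (x, v) _)
      (hH.fderiv_apply hΩ _) hΩ h]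
  exact fderiv_fderiv_apply_comm hΩ h hH _ _

theorem pdv_pdx_comm (hΩ : IsOpen Ω) (h : (x, v) ∈ Ω) (i : Fin n)
    (hH : SmoothOn Ω H) (j : Fin n) :
    pdv i (pdx j H) x v = pdx j (pdv i H) x v := by
  rw [pdv_congr hΩ (fun x v hx => pdx_eq hH hΩ hx j) h,
    pdx_congr hΩ (fun x v hx => pdv_eq hH hΩ hx i) h,
    pdv_eq (H := fun x v => fderiv ℝ (fun q : Model n × Model n => H q.1 q.2) (x, v) _)
      (hH.fderiv_apply hΩ _) hΩ h,
    pdx_eq (H := fun x v => fderiv ℝ (fun q : Model n × Model n => H q.1 q.2) (x, v) _)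
      (hH.fderiv_apply hΩ _) hΩ h]
  exact fderiv_fderiv_apply_comm hΩ h hH _ _

/-! ### Matrices of smooth functions -/

theorem SmoothOn.det {A : Model n → Model n → Matrix (Fin n) (Fin n) ℝ}
    (hA : ∀ i j, SmoothOn Ω fun x v => A x v i j) : SmoothOn Ω fun x v => (A x v).det := by
  simp_rw [Matrix.det_apply']
  exact SmoothOn.sum fun σ _ => (SmoothOn.const _).mul (SmoothOn.prod fun i _ => hA _ _)

/-- Cramer's rule: the entries of the inverse are polynomials in the entries of the matrix divided
by the determinant. -/
theorem SmoothOn.matrix_inv {A : Model n → Model n → Matrix (Fin n) (Fin n) ℝ}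
    (hA : ∀ i j, SmoothOn Ω fun x v => A x v i j) (h0 : ∀ x v, (x, v) ∈ Ω → (A x v).det ≠ 0)
    (i j : Fin n) : SmoothOn Ω fun x v => (A x v)⁻¹ i j := by
  have hadj : SmoothOn Ω fun x v => (A x v).adjugate i j := by
    simp_rw [Matrix.adjugate_apply]
    refine SmoothOn.det fun k l => ?_
    simp_rw [Matrix.updateRow_apply]
    by_cases hk : k = j
    · simpa [hk] using SmoothOn.const _
    · simpa [hk] using hA k l
  have hdet : SmoothOn Ω fun x v => ((A x v).det)⁻¹ :=
    ContDiffOn.inv (SmoothOn.det hA) fun q hq => h0 q.1 q.2 hq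
  refine (hdet.mul hadj).congr fun x v _ => ?_
  simp [Matrix.inv_def]

end

section

variable {n : ℕ}

/-! ### Linear algebra -/

/-- Jacobi's formula for the derivative of the determinant. -/
theorem hasFDerivAt_det {X : Type*} [NormedAddCommGroup X] [NormedSpace ℝ X]
    {B : X → Matrix (Fin n) (Fin n) ℝ} {B' : Fin n → Fin n → X →L[ℝ] ℝ} {y : X}
    (h : ∀ i j, HasFDerivAt (fun y => B y i j) (B' i j) y) :
    HasFDerivAt (fun y => (B y).det) (∑ i, ∑ j, (B y).adjugate j i • B' i j) y := by
  let D : ContinuousMultilinearMap ℝ (fun _ : Fin n => Fin n → ℝ) ℝ :=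
    { (Matrix.detRowAlternating (n := Fin n) (R := ℝ)).toMultilinearMap with
      cont := Continuous.matrix_det (A := fun M : Fin n → Fin n → ℝ => Matrix.of M) continuous_id }
  have hD : ∀ M : Matrix (Fin n) (Fin n) ℝ, D (fun i => M i) = M.det := fun M => rfl
  have h1 := HasFDerivAt.multilinear_comp (f := D) (g := fun i y => B y i)
    (g' := fun i => ContinuousLinearMap.pi (B' i)) (x := y) fun i => hasFDerivAt_pi.2 (h i)
  refine (h1.congr_fderiv ?_)
  ext a
  simp only [FunLike.coe_sum, Finset.sum_apply, ContinuousLinearMap.comp_apply,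
    smul_apply, smul_eq_mul]
  refine Finset.sum_congr rfl fun i _ => ?_
  -- The derivative of a multilinear map replaces one row at a time by its derivative; Cramer's rule
  -- expands the resulting determinant along that row through the adjugate.
  change ((B y).updateRow i (fun j => B' i j a)).det = _
  rw [← Matrix.cramer_transpose_apply, Matrix.cramer_eq_adjugate_mulVec,
    ← Matrix.adjugate_transpose]
  simp [Matrix.mulVec, dotProduct]

-- Positive elements of a C*-algebra have the form `B* B`. The factor `B` is an isometry from the
-- inner product `G` to the Euclidean one.
open scoped MatrixOrder Matrix.Norms.L2Operator in
theorem exists_transpose_mul_self_eq {G : Matrix (Fin n) (Fin n) ℝ} (hG : G.PosDef) :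
    ∃ B : Matrix (Fin n) (Fin n) ℝ, IsUnit B.det ∧ B.transpose * B = G := by
  obtain ⟨B, hB⟩ := CStarAlgebra.nonneg_iff_eq_star_mul_self.mp hG.posSemidef.nonneg
  have hB' : B.transpose * B = G := by
    rw [hB, Matrix.star_eq_conjTranspose, Matrix.conjTranspose_eq_transpose_of_trivial]
  refine ⟨B, ?_, hB'⟩
  have := hG.det_pos
  rw [← hB', Matrix.det_mul] at this
  exact isUnit_iff_ne_zero.2 (right_ne_zero_of_mul this.ne')

-- Cauchy–Schwarz in each row; symmetry makes the trace of `A²` the sum of the squared entries.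
open Matrix in
theorem dotProduct_mulVec_self_le_trace {A : Matrix (Fin n) (Fin n) ℝ} (hA : A.transpose = A)
    (w : Fin n → ℝ) : (A *ᵥ w) ⬝ᵥ (A *ᵥ w) ≤ (A * A).trace * (w ⬝ᵥ w) := by
  have h1 : (A * A).trace = ∑ i, ∑ j, A i j ^ 2 := by
    simp only [Matrix.trace, Matrix.diag, Matrix.mul_apply]
    refine Finset.sum_congr rfl fun i _ => Finset.sum_congr rfl fun j _ => ?_
    rw [sq, show A j i = A i j from congrFun (congrFun hA i) j]
  rw [h1, Finset.sum_mul]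
  refine Finset.sum_le_sum fun i _ => ?_
  have := Finset.sum_mul_sq_le_sq_mul_sq Finset.univ (A i) w
  simpa [Matrix.mulVec, dotProduct, sq] using this

open Matrix in
/-- The Hilbert–Schmidt norm of a `G`-symmetric endomorphism dominates its operator norm. -/
theorem mulVec_form_le_trace {G A : Matrix (Fin n) (Fin n) ℝ} (hG : G.PosDef)
    (hA : (G * A).transpose = G * A) (w : Fin n → ℝ) :
    (A *ᵥ w) ⬝ᵥ (G *ᵥ (A *ᵥ w)) ≤ (A * A).trace * (w ⬝ᵥ (G *ᵥ w)) := by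
  -- Conjugation by `B` turns the `G`-symmetric `A` into an ordinary symmetric matrix and does not
  -- change the trace of the square, so the Euclidean case applies to `B A B⁻¹` and `B w`.
  obtain ⟨B, hB, rfl⟩ := exists_transpose_mul_self_eq hG
  have hBi : B⁻¹ * B = 1 := Matrix.nonsing_inv_mul _ hB
  have hiB : B * B⁻¹ = 1 := Matrix.mul_nonsing_inv _ hB
  have hBt : B⁻¹ᵀ * Bᵀ = 1 := by rw [← Matrix.transpose_mul, hiB, Matrix.transpose_one]
  have hform : ∀ w, w ⬝ᵥ ((Bᵀ * B) *ᵥ w) = (B *ᵥ w) ⬝ᵥ (B *ᵥ w) := fun w => by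
    rw [← Matrix.mulVec_mulVec, Matrix.dotProduct_mulVec, Matrix.vecMul_transpose]
  have hsymm : (B * A * B⁻¹)ᵀ = B * A * B⁻¹ := by
    have h2 : Aᵀ * Bᵀ * B = Bᵀ * B * A := by
      rw [← hA, Matrix.transpose_mul, Matrix.transpose_mul, Matrix.transpose_transpose,
        ← Matrix.mul_assoc]
    calc (B * A * B⁻¹)ᵀ = B⁻¹ᵀ * (Aᵀ * Bᵀ * B) * B⁻¹ := by
          rw [Matrix.transpose_mul, Matrix.transpose_mul]
          simp only [Matrix.mul_assoc, hiB, Matrix.mul_one]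
      _ = (B⁻¹ᵀ * Bᵀ) * (B * A * B⁻¹) := by rw [h2]; simp only [Matrix.mul_assoc]
      _ = _ := by rw [hBt, Matrix.one_mul]
  have key := dotProduct_mulVec_self_le_trace hsymm (B *ᵥ w)
  have h3 : (B * A * B⁻¹) *ᵥ (B *ᵥ w) = B *ᵥ (A *ᵥ w) := by
    simp only [Matrix.mulVec_mulVec, Matrix.mul_assoc, hBi, Matrix.mul_one]
  have h4 : ((B * A * B⁻¹) * (B * A * B⁻¹)).trace = (A * A).trace := by
    have : (B * A * B⁻¹) * (B * A * B⁻¹) = B * ((A * A) * B⁻¹) := by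
      simp only [Matrix.mul_assoc]
      rw [← Matrix.mul_assoc B⁻¹ B, hBi, Matrix.one_mul]
    rw [this, Matrix.trace_mul_comm, Matrix.mul_assoc, hBi, Matrix.mul_one]
  rw [hform, hform]
  rwa [h3, h4] at key

end

section

variable {n : ℕ}

/-! ### Minkowski norms -/

/-- A (non-reversible) smooth, strongly convex norm on `ℝⁿ`. -/
structure IsMinkowskiNorm (f : Model n → ℝ) : Prop where
  nonneg : ∀ v, 0 ≤ f v
  contDiffOn : ContDiffOn ℝ ∞ f {0}ᶜ
  homogeneous : ∀ (v : Model n) (c : ℝ), 0 ≤ c → f (c • v) = c * f v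
  halfHess_pos : ∀ v w, v ≠ 0 → w ≠ 0 → 0 < halfHess f v w w

/-- The differential of `f² / 2`. -/
def momentum (f : Model n → ℝ) (v : Model n) : Model n →L[ℝ] ℝ :=
  (1 / 2 : ℝ) • fderiv ℝ (fun z => f z ^ 2) v

theorem halfHess_eq_fderiv_momentum (f : Model n → ℝ) (v a b : Model n) :
    halfHess f v a b = fderiv ℝ (fun w => momentum f w b) v a :=
  (congrArg (fun l => l v a) (fderiv_const_smul_field (𝕜 := ℝ)
    (f := fun w => fderiv ℝ (fun z => f z ^ 2) w b) (1 / 2 : ℝ))).symm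

/-- Chain rule for a linear change of coordinates; no differentiability is needed because `L` is
invertible. With `L` the differential of an inverse chart it moves momenta between a chart and the
fibre. -/
theorem momentum_comp (f : Model n → ℝ) (L : Model n ≃L[ℝ] Model n) (v a : Model n) :
    momentum (fun w => f (L w)) v a = momentum f (L v) (L a) := by
  have := L.comp_right_fderiv (f := fun z => f z ^ 2) (x := v)
  simp only [momentum, smul_apply]
  exact congrArg (fun l => (1 / 2 : ℝ) • l a) this

theorem halfHess_comp (f : Model n → ℝ) (L : Model n ≃L[ℝ] Model n) (v a b : Model n) :
    halfHess (fun w => f (L w)) v a b = halfHess f (L v) (L a) (L b) := by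
  have := L.comp_right_fderiv (f := fun z => momentum f z (L b)) (x := v)
  simp only [halfHess_eq_fderiv_momentum, momentum_comp]
  exact congrArg (fun l => l a) this

namespace IsMinkowskiNorm

variable {f : Model n → ℝ} {v w : Model n}

theorem map_zero (hf : IsMinkowskiNorm f) : f 0 = 0 := by simpa using hf.homogeneous 0 0 le_rfl

theorem comp (hf : IsMinkowskiNorm f) (L : Model n ≃L[ℝ] Model n) :
    IsMinkowskiNorm fun w => f (L w) where
  nonneg v := hf.nonneg _
  contDiffOn := hf.contDiffOn.comp L.contDiff.contDiffOn fun v hv => by simpa using hv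
  homogeneous v c hc := by simp [hf.homogeneous _ c hc]
  halfHess_pos v w hv hw := by
    rw [halfHess_comp]
    exact hf.halfHess_pos _ _ (by simpa using hv) (by simpa using hw)

theorem contDiffOn_sq (hf : IsMinkowskiNorm f) :
    ContDiffOn ℝ ∞ (fun z => f z ^ 2) {0}ᶜ := hf.contDiffOn.pow 2

theorem contDiffOn_momentum (hf : IsMinkowskiNorm f) : ContDiffOn ℝ ∞ (momentum f) {0}ᶜ :=
  (hf.contDiffOn_sq.fderiv_of_isOpen isOpen_compl_singleton (by simp)).const_smul (1 / 2 : ℝ)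

theorem differentiableAt (hf : IsMinkowskiNorm f) (hv : v ≠ 0) : DifferentiableAt ℝ f v :=
  (hf.contDiffOn.contDiffAt (isOpen_compl_singleton.mem_nhds hv)).differentiableAt (by simp)

theorem differentiableAt_momentum (hf : IsMinkowskiNorm f) (hv : v ≠ 0) :
    DifferentiableAt ℝ (momentum f) v :=
  (hf.contDiffOn_momentum.contDiffAt (isOpen_compl_singleton.mem_nhds hv)).differentiableAt
    (by simp)

theorem momentum_eq (hf : IsMinkowskiNorm f) (hv : v ≠ 0) : momentum f v = f v • fderiv ℝ f v := by
  have h : HasFDerivAt (fun z => f z ^ 2) _ v := (hf.differentiableAt hv).hasFDerivAt.pow 2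
  rw [momentum, h.fderiv, smul_smul]
  congr 1
  simp

/-- Euler's identity: both sides are the derivative of `t ↦ f (t • v)` at `t = 1`. -/
theorem fderiv_self (hf : IsMinkowskiNorm f) (hv : v ≠ 0) : fderiv ℝ f v v = f v := by
  have h1 : HasDerivAt (fun t : ℝ => f (t • v)) (fderiv ℝ f v v) 1 := by
    have h : HasFDerivAt f (fderiv ℝ f v) ((1 : ℝ) • v) := by
      simpa using (hf.differentiableAt hv).hasFDerivAt
    have h' : HasDerivAt (fun t : ℝ => t • v) v 1 := by
      simpa using (hasDerivAt_id (1 : ℝ)).smul_const v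
    exact h.comp_hasDerivAt 1 h'
  have h2 : HasDerivAt (fun t : ℝ => f (t • v)) (f v) 1 := by
    have : HasDerivAt (fun t : ℝ => t * f v) (f v) 1 := by
      simpa using (hasDerivAt_id (1 : ℝ)).mul_const (f v)
    refine this.congr_of_eventuallyEq ?_
    filter_upwards [Ioi_mem_nhds (show (0 : ℝ) < 1 by norm_num)] with t ht
    exact hf.homogeneous v t (le_of_lt ht)
  exact h1.unique h2

theorem momentum_self (hf : IsMinkowskiNorm f) (hv : v ≠ 0) : momentum f v v = f v ^ 2 := by
  rw [hf.momentum_eq hv, smul_apply, hf.fderiv_self hv, smul_eq_mul, sq]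

theorem halfHess_eq (hf : IsMinkowskiNorm f) (hv : v ≠ 0) (a b : Model n) :
    halfHess f v a b = fderiv ℝ (momentum f) v a b := by
  rw [halfHess_eq_fderiv_momentum, fderiv_clm_apply (hf.differentiableAt_momentum hv)
    (differentiableAt_const b)]
  simp

theorem halfHess_symm (hf : IsMinkowskiNorm f) (hv : v ≠ 0) (a b : Model n) :
    halfHess f v a b = halfHess f v b a := by
  have hc := hf.contDiffOn_sq.contDiffAt (isOpen_compl_singleton.mem_nhds hv)
  have hs := hc.isSymmSndFDerivAt (by simp; exact WithTop.coe_le_coe.mpr (mod_cast le_top))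
  have hd : DifferentiableAt ℝ (fderiv ℝ (fun z => f z ^ 2)) v :=
    ((hf.contDiffOn_sq.fderiv_of_isOpen isOpen_compl_singleton (m := 1)
      (by norm_cast)).contDiffAt (isOpen_compl_singleton.mem_nhds hv)).differentiableAt (by simp)
  simp only [halfHess]
  rw [fderiv_clm_apply hd (differentiableAt_const b),
    fderiv_clm_apply hd (differentiableAt_const a)]
  simpa using hs a b

/-- Differentiate `momentum f w w = f w ^ 2` in `w`: the product rule gives the Hessian term plus
the momentum, the right-hand side gives twice the momentum. -/
theorem halfHess_self_right (hf : IsMinkowskiNorm f) (hv : v ≠ 0) (a : Model n) :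
    halfHess f v a v = momentum f v a := by
  have h1 : fderiv ℝ (fun w => momentum f w w) v a = 2 * momentum f v a := by
    have : (fun w => momentum f w w) =ᶠ[nhds v] fun w => f w ^ 2 := by
      filter_upwards [isOpen_compl_singleton.mem_nhds hv] with w hw using hf.momentum_self hw
    rw [this.fderiv_eq]
    simp [momentum]
  rw [fderiv_clm_apply (hf.differentiableAt_momentum hv) differentiableAt_fun_id] at h1
  rw [hf.halfHess_eq hv]
  simp at h1
  linarith

theorem halfHess_self_left (hf : IsMinkowskiNorm f) (hv : v ≠ 0) (a : Model n) :
    halfHess f v v a = momentum f v a := by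
  rw [hf.halfHess_symm hv, hf.halfHess_self_right hv]

/-- Positivity is a consequence of strong convexity, since `g_v(v, v) = f(v)²`. -/
theorem pos (hf : IsMinkowskiNorm f) (hv : v ≠ 0) : 0 < f v := by
  have := hf.halfHess_pos v v hv hv
  rw [hf.halfHess_self_right hv, hf.momentum_self hv] at this
  exact lt_of_le_of_ne (hf.nonneg v) fun h => by simp [← h] at this

theorem halfHess_eq_sum (hf : IsMinkowskiNorm f) (hv : v ≠ 0) (a b : Model n) :
    halfHess f v a b = ∑ i, a i * ∑ j, gMatrix f v i j * b j := by
  rw [hf.halfHess_eq hv]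
  have h1 := map_eq_sum_basisVec ((fderiv ℝ (momentum f) v).flip b) a
  simp only [ContinuousLinearMap.flip_apply] at h1
  rw [h1]
  refine Finset.sum_congr rfl fun i _ => ?_
  rw [map_eq_sum_basisVec (fderiv ℝ (momentum f) v (basisVec i)) b]
  congr 1
  refine Finset.sum_congr rfl fun j _ => ?_
  rw [mul_comm, gMatrix, Matrix.of_apply, hf.halfHess_eq hv]

open Matrix in
theorem halfHess_eq_dotProduct (hf : IsMinkowskiNorm f) (hv : v ≠ 0) (a b : Model n) :
    halfHess f v a b = a.ofLp ⬝ᵥ (gMatrix f v *ᵥ b.ofLp) := hf.halfHess_eq_sum hv a b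

theorem gMatrix_symm (hf : IsMinkowskiNorm f) (hv : v ≠ 0) (i j : Fin n) :
    gMatrix f v i j = gMatrix f v j i :=
  hf.halfHess_symm hv _ _

theorem gMatrix_posDef (hf : IsMinkowskiNorm f) (hv : v ≠ 0) : (gMatrix f v).PosDef := by
  refine Matrix.PosDef.of_dotProduct_mulVec_pos ?_ fun w hw => ?_
  · ext i j
    simpa using hf.gMatrix_symm hv j i
  · have hw' : WithLp.toLp 2 w ≠ (0 : Model n) := fun h => hw (by
      simpa using congrArg WithLp.ofLp h)
    have := hf.halfHess_pos v (WithLp.toLp 2 w) hv hw'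
    rw [hf.halfHess_eq_dotProduct hv] at this
    simpa using this

theorem eq_of_halfHess_eq (hf : IsMinkowskiNorm f) (hv : v ≠ 0) {a a' : Model n}
    (h : ∀ b, halfHess f v a b = halfHess f v a' b) : a = a' := by
  by_contra hne
  have hpos := hf.halfHess_pos v (a - a') hv (sub_ne_zero.2 hne)
  have h' := h (a - a')
  rw [hf.halfHess_eq hv] at hpos
  rw [hf.halfHess_eq hv, hf.halfHess_eq hv] at h'
  rw [(fderiv ℝ (momentum f) v).map_sub, sub_apply, h', sub_self] at hpos
  exact lt_irrefl _ hpos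

/-- The differential of a strictly convex function is strictly monotone along segments. Smoothness
fails at the origin, so the segment from `v` to `w` has to avoid it. -/
theorem momentum_injective (hf : IsMinkowskiNorm f) (hv : v ≠ 0) (hw : w ≠ 0)
    (h : momentum f v = momentum f w) :
    v = w := by
  by_contra hne
  have hav : 0 < momentum f v v := by
    rw [hf.momentum_self hv]; exact pow_pos (hf.pos hv) 2
  have haw : 0 < momentum f v w := by
    rw [h, hf.momentum_self hw]; exact pow_pos (hf.pos hw) 2
  -- The common momentum is a linear form that is positive at both ends of the segment, hence on all
  -- of it.
  have hseg : ∀ t ∈ Set.Icc (0 : ℝ) 1, v + t • (w - v) ≠ 0 := by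
    intro t ht h0
    have h1 := congrArg (momentum f v) h0
    simp only [map_add, map_smul, map_sub, _root_.map_zero, smul_eq_mul] at h1
    rcases ht.1.eq_or_lt with rfl | h0t
    · simp at h1; exact hav.ne' h1
    · nlinarith [mul_pos h0t haw, mul_nonneg (sub_nonneg.2 ht.2) hav.le]
  have hder : ∀ t ∈ Set.Icc (0 : ℝ) 1, HasDerivAt
      (fun t : ℝ => momentum f (v + t • (w - v)) (w - v))
      (halfHess f (v + t • (w - v)) (w - v) (w - v)) t := by
    intro t ht
    have h1 : HasDerivAt (fun t : ℝ => v + t • (w - v)) (w - v) t := by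
      simpa using ((hasDerivAt_id t).smul_const (w - v)).const_add v
    have h2 := (hf.differentiableAt_momentum (hseg t ht)).hasFDerivAt.comp_hasDerivAt t h1
    rw [hf.halfHess_eq (hseg t ht)]
    simpa using h2.clm_apply (hasDerivAt_const t (w - v))
  have hmono : StrictMonoOn (fun t : ℝ => momentum f (v + t • (w - v)) (w - v))
      (Set.Icc (0 : ℝ) 1) := by
    refine strictMonoOn_of_deriv_pos (convex_Icc 0 1)
      (fun t ht => (hder t ht).continuousAt.continuousWithinAt) fun t ht => ?_
    rw [interior_Icc] at ht
    have ht' := Set.Ioo_subset_Icc_self ht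
    rw [(hder t ht').deriv]
    exact hf.halfHess_pos _ _ (hseg t ht') (sub_ne_zero.2 (Ne.symm hne))
  have := hmono (by simp) (by simp) (show (0 : ℝ) < 1 by norm_num)
  simp [h] at this

/-- The quotient `α / f` is 0-homogeneous and continuous away from the origin, so it attains its
maximum on the compact Euclidean sphere; the maximizer is then rescaled to `f = 1`. -/
theorem exists_norming_vector (hf : IsMinkowskiNorm f) {α : Model n →L[ℝ] ℝ} (hα : α ≠ 0) :
    ∃ s > 0, ∃ v, f v = 1 ∧ α v = s ∧ ∀ w, α w ≤ s * f w := by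
  obtain ⟨a, ha⟩ : ∃ a, 0 < α a := by
    obtain ⟨a, ha⟩ : ∃ a, α a ≠ 0 := by
      by_contra! h
      exact hα (ContinuousLinearMap.ext h)
    rcases ha.lt_or_gt with h | h
    · exact ⟨-a, by simpa using h⟩
    · exact ⟨a, h⟩
  have ha0 : a ≠ 0 := fun h => by simp [h] at ha
  have hne0 : ∀ v ∈ Metric.sphere (0 : Model n) 1, v ≠ 0 := fun v hv h => by simp [h] at hv
  have hunit : ∀ v : Model n, v ≠ 0 → ‖v‖⁻¹ • v ∈ Metric.sphere (0 : Model n) 1 := by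
    intro v hv
    simp [norm_smul, inv_mul_cancel₀ (norm_ne_zero_iff.2 hv)]
  have hratio : ∀ v : Model n, v ≠ 0 → α (‖v‖⁻¹ • v) / f (‖v‖⁻¹ • v) = α v / f v := by
    intro v hv
    rw [hf.homogeneous _ _ (by positivity), map_smul, smul_eq_mul,
      mul_div_mul_left _ _ (inv_ne_zero (norm_ne_zero_iff.2 hv))]
  obtain ⟨b, hb, hmax⟩ := (isCompact_sphere (0 : Model n) 1).exists_isMaxOn ⟨_, hunit a ha0⟩
    (f := fun v => α v / f v) (by
      refine ContinuousOn.div α.continuous.continuousOn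
        (hf.contDiffOn.continuousOn.mono hne0) fun v hv => (hf.pos (hne0 v hv)).ne')
  have hb0 := hne0 b hb
  have hle : ∀ w, w ≠ 0 → α w / f w ≤ α b / f b := fun w hw => by
    rw [← hratio w hw]; exact hmax (hunit w hw)
  refine ⟨α b / f b, (div_pos ha (hf.pos ha0)).trans_le (hle a ha0), (f b)⁻¹ • b, ?_, ?_, ?_⟩
  · rw [hf.homogeneous _ _ (inv_nonneg.2 (hf.nonneg b)), inv_mul_cancel₀ (hf.pos hb0).ne']
  · rw [map_smul, smul_eq_mul, div_eq_inv_mul]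
  · intro w
    by_cases hw : w = 0
    · simp [hw, hf.map_zero]
    · exact (div_le_iff₀ (hf.pos hw)).1 (hle w hw)

/-- The supremum is attained, so `s > 0` and `α ≤ s f`. A vector with `f v = s` and `α v = s²` is a
zero of the nonnegative function `s f - α`, and the first-order condition `s df = α` at this minimum
is the momentum equation. -/
theorem legendre_spec (hf : IsMinkowskiNorm f) {α : Model n →L[ℝ] ℝ} (hα : α ≠ 0) {s : ℝ}
    (hs : s = sSup {r : ℝ | ∃ v : Model n, f v ≤ 1 ∧ r = α v}) :
    (∃ v, f v = s ∧ α v = s ^ 2) ∧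
      ∀ v, f v = s → α v = s ^ 2 → v ≠ 0 ∧ momentum f v = α := by
  obtain ⟨s', hs', v₀, hv₀, hαv₀, hmax⟩ := hf.exists_norming_vector hα
  have hgr : IsGreatest {r : ℝ | ∃ v : Model n, f v ≤ 1 ∧ r = α v} s' := by
    refine ⟨⟨v₀, hv₀.le, hαv₀.symm⟩, ?_⟩
    rintro r ⟨v, hv, rfl⟩
    exact (hmax v).trans (mul_le_of_le_one_right hs'.le hv)
  rw [hgr.csSup_eq] at hs
  subst hs
  refine ⟨⟨s • v₀, ?_, ?_⟩, fun v hv hαv => ?_⟩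
  · rw [hf.homogeneous _ _ hs'.le, hv₀, mul_one]
  · rw [map_smul, hαv₀, smul_eq_mul, sq]
  · have hv0 : v ≠ 0 := by
      rintro rfl
      rw [hf.map_zero] at hv
      exact hs'.ne hv
    refine ⟨hv0, ?_⟩
    have hmin : IsLocalMin (fun w => s * f w - α w) v := by
      refine Filter.Eventually.of_forall fun w => ?_
      change s * f v - α v ≤ s * f w - α w
      rw [hv, hαv]
      have := hmax w
      nlinarith
    have hd : HasFDerivAt (fun w => s * f w - α w) (s • fderiv ℝ f v - α) v :=
      ((hf.differentiableAt hv0).hasFDerivAt.const_mul s).sub α.hasFDerivAt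
    have := hmin.hasFDerivAt_eq_zero hd
    rw [hf.momentum_eq hv0, hv]
    exact sub_eq_zero.1 this

end IsMinkowskiNorm

end

section

variable {n : ℕ}

/-! ### Finsler structures in coordinates -/

/-- `f` is the coordinate expression of a Finsler structure over the open set `O`. -/
structure IsFinslerOn (O : Set (Model n)) (f : Model n → Model n → ℝ) : Prop where
  isOpen : IsOpen O
  smooth : SmoothOn (O ×ˢ {0}ᶜ) f
  minkowski : ∀ x ∈ O, IsMinkowskiNorm (f x)

/-- The energy `f² / 2`. -/
def energy (f : Model n → Model n → ℝ) (x v : Model n) : ℝ := (1 / 2) * f x v ^ 2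

/-- The components `∂(f² / 2)/∂vⁱ` of the Legendre transform. -/
def covec (f : Model n → Model n → ℝ) (i : Fin n) : Model n → Model n → ℝ := pdv i (energy f)

/-- The derivative `∑ vʲ ∂H/∂xʲ - ∑ Gʲ ∂H/∂vʲ` of `H` along the geodesic flow. -/
def sprayDeriv (f H : Model n → Model n → ℝ) (x v : Model n) : ℝ :=
  ∑ j, v j * pdx j H x v - ∑ j, spray f j x v * pdv j H x v

theorem covec_eq_momentum (f : Model n → Model n → ℝ) (i : Fin n) (x v : Model n) :
    covec f i x v = momentum (f x) v (basisVec i) :=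
  pdv_const_mul (H := fun x v => f x v ^ 2) i (1 / 2)

theorem gLow_eq (f : Model n → Model n → ℝ) (i j : Fin n) : gLow f i j = pdv i (covec f j) := by
  ext x v
  simp only [gLow, gMatrix, Matrix.of_apply, halfHess_eq_fderiv_momentum, pdv, covec_eq_momentum]

namespace IsFinslerOn

variable {O : Set (Model n)} {f : Model n → Model n → ℝ} {x v : Model n}

theorem isOpen_prod (hf : IsFinslerOn O f) : IsOpen (O ×ˢ ({0}ᶜ : Set (Model n))) :=
  hf.isOpen.prod isOpen_compl_singleton

theorem smooth_energy (hf : IsFinslerOn O f) : SmoothOn (O ×ˢ {0}ᶜ) (energy f) :=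
  (SmoothOn.const _).mul (ContDiffOn.pow hf.smooth 2)

theorem smooth_covec (hf : IsFinslerOn O f) (i : Fin n) : SmoothOn (O ×ˢ {0}ᶜ) (covec f i) :=
  hf.smooth_energy.pdv hf.isOpen_prod i

theorem smooth_gLow (hf : IsFinslerOn O f) (i j : Fin n) : SmoothOn (O ×ˢ {0}ᶜ) (gLow f i j) := by
  rw [gLow_eq]
  exact (hf.smooth_covec j).pdv hf.isOpen_prod i

theorem isUnit_det (hf : IsFinslerOn O f) (h : (x, v) ∈ O ×ˢ ({0}ᶜ : Set (Model n))) :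
    IsUnit (gMatrix (f x) v).det :=
  isUnit_iff_ne_zero.2 ((hf.minkowski x h.1).gMatrix_posDef h.2).det_pos.ne'

theorem smooth_gUp (hf : IsFinslerOn O f) (i j : Fin n) : SmoothOn (O ×ˢ {0}ᶜ) (gUp f i j) :=
  SmoothOn.matrix_inv (A := fun x v => gMatrix (f x) v) hf.smooth_gLow
    (fun _ _ h => (hf.isUnit_det h).ne_zero) i j

theorem smooth_spray (hf : IsFinslerOn O f) (i : Fin n) : SmoothOn (O ×ˢ {0}ᶜ) (spray f i) := by
  have hx := fun i j k => (hf.smooth_gLow i j).pdx hf.isOpen_prod k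
  refine SmoothOn.sum fun j _ => SmoothOn.sum fun k _ => SmoothOn.mul (SmoothOn.mul ?_ ?_) ?_
  · exact (SmoothOn.const _).mul (SmoothOn.sum fun l _ =>
      (hf.smooth_gUp i l).mul (((hx l k j).add (hx j l k)).sub (hx j k l)))
  · exact SmoothOn.coord j
  · exact SmoothOn.coord k

theorem smooth_nonlinConn (hf : IsFinslerOn O f) (i j : Fin n) :
    SmoothOn (O ×ˢ {0}ᶜ) (nonlinConn f i j) :=
  (SmoothOn.const _).mul ((hf.smooth_spray i).pdv hf.isOpen_prod j)

theorem pdv_spray (f : Model n → Model n → ℝ) (i j : Fin n) (x v : Model n) :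
    pdv j (spray f i) x v = 2 * nonlinConn f i j x v := by
  simp [nonlinConn]

theorem gLow_symm (hf : IsFinslerOn O f) (h : (x, v) ∈ O ×ˢ ({0}ᶜ : Set (Model n)))
    (i j : Fin n) : gLow f i j x v = gLow f j i x v :=
  (hf.minkowski x h.1).gMatrix_symm h.2 i j

theorem sum_coord_mul_covec (hf : IsFinslerOn O f) (h : (x, v) ∈ O ×ˢ ({0}ᶜ : Set (Model n))) :
    ∑ k, v k * covec f k x v = 2 * energy f x v := by
  simp_rw [covec_eq_momentum]
  rw [← map_eq_sum_basisVec, (hf.minkowski x h.1).momentum_self h.2, energy]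
  ring

theorem sum_coord_mul_gLow (hf : IsFinslerOn O f) (h : (x, v) ∈ O ×ˢ ({0}ᶜ : Set (Model n)))
    (l : Fin n) : ∑ k, v k * gLow f l k x v = covec f l x v := by
  have h1 := pdv_congr hf.isOpen_prod (fun x v h => hf.sum_coord_mul_covec h) h l
  rw [pdv_sum_coord_mul hf.isOpen_prod h l hf.smooth_covec, pdv_const_mul] at h1
  simp_rw [gLow_eq]
  change covec f l x v + _ = 2 * covec f l x v at h1
  linarith

/-- The Cartan tensor annihilates `v`: in the `vʲ`-derivative of `sum_coord_mul_gLow`, the term from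
differentiating the factor `vᵏ` already equals the right-hand side. -/
theorem sum_coord_mul_pdv_gLow (hf : IsFinslerOn O f) (h : (x, v) ∈ O ×ˢ ({0}ᶜ : Set (Model n)))
    (j l : Fin n) : ∑ k, v k * pdv j (gLow f l k) x v = 0 := by
  have h1 := pdv_congr hf.isOpen_prod (fun x v h => hf.sum_coord_mul_gLow h l) h j
  rw [pdv_sum_coord_mul hf.isOpen_prod h j (hf.smooth_gLow l), ← gLow_eq, hf.gLow_symm h] at h1
  linarith

theorem sum_coord_mul_pdx_covec (hf : IsFinslerOn O f)
    (h : (x, v) ∈ O ×ˢ ({0}ᶜ : Set (Model n))) (l : Fin n) :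
    ∑ k, v k * pdx l (covec f k) x v = 2 * pdx l (energy f) x v := by
  have h1 := pdx_congr hf.isOpen_prod (fun x v h => hf.sum_coord_mul_covec h) h l
  rwa [pdx_sum_coord_mul hf.isOpen_prod h l hf.smooth_covec, pdx_const_mul] at h1

theorem sum_coord_mul_pdx_gLow (hf : IsFinslerOn O f)
    (h : (x, v) ∈ O ×ˢ ({0}ᶜ : Set (Model n))) (j l : Fin n) :
    ∑ k, v k * pdx j (gLow f l k) x v = pdx j (covec f l) x v := by
  have h1 := pdx_congr hf.isOpen_prod (fun x v h => hf.sum_coord_mul_gLow h l) h j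
  rwa [pdx_sum_coord_mul hf.isOpen_prod h j (hf.smooth_gLow l)] at h1

theorem pdx_gLow_symm (hf : IsFinslerOn O f)
    (h : (x, v) ∈ O ×ˢ ({0}ᶜ : Set (Model n))) (i j l : Fin n) :
    pdx i (gLow f j l) x v = pdx i (gLow f l j) x v :=
  pdx_congr hf.isOpen_prod (fun _ _ h => hf.gLow_symm h j l) h i

theorem sum_gLow_mul_formalChristoffel (hf : IsFinslerOn O f)
    (h : (x, v) ∈ O ×ˢ ({0}ᶜ : Set (Model n))) (m j k : Fin n) :
    ∑ i, gLow f m i x v * formalChristoffel f i j k x v =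
      (1 / 2) * (pdx j (gLow f m k) x v + pdx k (gLow f j m) x v - pdx m (gLow f j k) x v) := by
  set T : Fin n → ℝ := fun l =>
    pdx j (gLow f l k) x v + pdx k (gLow f j l) x v - pdx l (gLow f j k) x v with hT
  have h1 : gMatrix (f x) v * (gMatrix (f x) v)⁻¹ = 1 := Matrix.mul_nonsing_inv _ (hf.isUnit_det h)
  have h2 : (gMatrix (f x) v).mulVec ((gMatrix (f x) v)⁻¹.mulVec T) = T := by
    rw [Matrix.mulVec_mulVec, h1, Matrix.one_mulVec]
  have h3 := congrFun h2 m
  simp only [Matrix.mulVec, dotProduct] at h3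
  change _ = (1 / 2) * T m
  rw [← h3, Finset.mul_sum]
  refine Finset.sum_congr rfl fun i _ => ?_
  simp only [gLow, formalChristoffel, gUp, hT]
  ring

/-- The Euler–Lagrange equation of the energy. -/
theorem sum_gLow_mul_spray (hf : IsFinslerOn O f)
    (h : (x, v) ∈ O ×ˢ ({0}ᶜ : Set (Model n))) (m : Fin n) :
    ∑ i, gLow f m i x v * spray f i x v =
      ∑ j, v j * pdx j (covec f m) x v - pdx m (energy f) x v := by
  have h1 : ∑ i, gLow f m i x v * spray f i x v =
      ∑ j, ∑ k, (∑ i, gLow f m i x v * formalChristoffel f i j k x v) * v j * v k := by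
    simp only [spray, Finset.mul_sum, Finset.sum_mul]
    rw [Finset.sum_comm]
    refine Finset.sum_congr rfl fun j _ => ?_
    rw [Finset.sum_comm]
    refine Finset.sum_congr rfl fun k _ => Finset.sum_congr rfl fun i _ => ?_
    ring
  -- After contraction with `vʲ vᵏ` the first two terms of the Christoffel symbol coincide;
  -- homogeneity rewrites them through the momentum and the third through the energy.
  have e1 : ∑ j, ∑ k, pdx j (gLow f m k) x v * v j * v k = ∑ j, v j * pdx j (covec f m) x v := by
    refine Finset.sum_congr rfl fun j _ => ?_
    rw [← hf.sum_coord_mul_pdx_gLow h, Finset.mul_sum]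
    exact Finset.sum_congr rfl fun k _ => by ring
  have e2 : ∑ j, ∑ k, pdx k (gLow f j m) x v * v j * v k = ∑ j, v j * pdx j (covec f m) x v := by
    rw [← e1, Finset.sum_comm]
    refine Finset.sum_congr rfl fun j _ => Finset.sum_congr rfl fun k _ => ?_
    rw [hf.pdx_gLow_symm h]
    ring
  have e3 : ∑ j, ∑ k, pdx m (gLow f j k) x v * v j * v k = 2 * pdx m (energy f) x v := by
    rw [← hf.sum_coord_mul_pdx_covec h]
    refine Finset.sum_congr rfl fun j _ => ?_
    rw [← hf.sum_coord_mul_pdx_gLow h, Finset.mul_sum]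
    exact Finset.sum_congr rfl fun k _ => by ring
  have h2 : ∑ i, gLow f m i x v * spray f i x v = (1 / 2) *
      (∑ j, ∑ k, pdx j (gLow f m k) x v * v j * v k + ∑ j, ∑ k, pdx k (gLow f j m) x v * v j * v k
        - ∑ j, ∑ k, pdx m (gLow f j k) x v * v j * v k) := by
    rw [h1]
    simp only [hf.sum_gLow_mul_formalChristoffel h, Finset.mul_sum, ← Finset.sum_add_distrib,
      ← Finset.sum_sub_distrib]
    refine Finset.sum_congr rfl fun j _ => Finset.sum_congr rfl fun k _ => ?_
    ring
  rw [h2, e1, e2, e3]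
  ring

/-- The Cartan tensor is a third derivative of the energy, hence totally symmetric. -/
theorem pdv_gLow_comm (hf : IsFinslerOn O f)
    (h : (x, v) ∈ O ×ˢ ({0}ᶜ : Set (Model n))) (k m i : Fin n) :
    pdv k (gLow f m i) x v = pdv i (gLow f k m) x v := by
  rw [pdv_congr hf.isOpen_prod (fun _ _ h => hf.gLow_symm h m i) h, gLow_eq, gLow_eq,
    pdv_pdv_comm hf.isOpen_prod h k (hf.smooth_covec m) i]

/-- This is the `vᵏ`-derivative of the Euler–Lagrange equation; the symmetry of the Cartan tensor
turns `∂g_{mi}/∂vᵏ Gⁱ` into the vertical part of `sprayDeriv`. The left side is symmetric in `k, m`,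
so the symmetric and antisymmetric parts of the right side give two separate identities. -/
theorem sprayDeriv_gLow_aux (hf : IsFinslerOn O f)
    (h : (x, v) ∈ O ×ˢ ({0}ᶜ : Set (Model n))) (k m : Fin n) :
    sprayDeriv f (gLow f k m) x v = 2 * ∑ i, gLow f m i x v * nonlinConn f i k x v
      - pdx k (covec f m) x v + pdx m (covec f k) x v := by
  have hΩ := hf.isOpen_prod
  have h1 := pdv_congr hΩ (fun x v h => hf.sum_gLow_mul_spray h m) h k
  rw [pdv_sum hΩ h k fun i _ => (hf.smooth_gLow m i).mul (hf.smooth_spray i),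
    pdv_sub hΩ h k (SmoothOn.sum fun j _ => (SmoothOn.coord j).mul ((hf.smooth_covec m).pdx hΩ j))
      (hf.smooth_energy.pdx hΩ m),
    pdv_sum_coord_mul hΩ h k fun j => (hf.smooth_covec m).pdx hΩ j,
    pdv_pdx_comm hΩ h k hf.smooth_energy m] at h1
  simp_rw [pdv_mul hΩ h k (hf.smooth_gLow m _) (hf.smooth_spray _), pdv_spray,
    pdv_pdx_comm hΩ h k (hf.smooth_covec m), ← gLow_eq, hf.pdv_gLow_comm h k m,
    Finset.sum_add_distrib] at h1
  have e1 : ∑ i, gLow f m i x v * (2 * nonlinConn f i k x v) =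
      2 * ∑ i, gLow f m i x v * nonlinConn f i k x v := by
    rw [Finset.mul_sum]
    exact Finset.sum_congr rfl fun i _ => by ring
  have e2 : ∑ i, pdv i (gLow f k m) x v * spray f i x v =
      ∑ i, spray f i x v * pdv i (gLow f k m) x v :=
    Finset.sum_congr rfl fun i _ => by ring
  rw [e1, e2] at h1
  change _ = _ + _ - pdx m (covec f k) x v at h1
  rw [sprayDeriv]
  linarith

theorem sprayDeriv_gLow_symm (hf : IsFinslerOn O f)
    (h : (x, v) ∈ O ×ˢ ({0}ᶜ : Set (Model n))) (k m : Fin n) :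
    sprayDeriv f (gLow f k m) x v = sprayDeriv f (gLow f m k) x v := by
  simp only [sprayDeriv]
  congr 1
  · exact Finset.sum_congr rfl fun j _ => by rw [hf.pdx_gLow_symm h]
  · exact Finset.sum_congr rfl fun j _ => by
      rw [pdv_congr hf.isOpen_prod (fun _ _ h => hf.gLow_symm h k m) h]

/-- The metric is parallel along the geodesic flow. -/
theorem sprayDeriv_gLow (hf : IsFinslerOn O f)
    (h : (x, v) ∈ O ×ˢ ({0}ᶜ : Set (Model n))) (k m : Fin n) :
    sprayDeriv f (gLow f k m) x v =
      ∑ i, gLow f m i x v * nonlinConn f i k x v + ∑ i, gLow f k i x v * nonlinConn f i m x v := by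
  have h1 := hf.sprayDeriv_gLow_aux h k m
  have h2 := hf.sprayDeriv_gLow_aux h m k
  rw [hf.sprayDeriv_gLow_symm h m k] at h2
  linarith

/-- The antisymmetric part of `sprayDeriv_gLow_aux`. It makes the Hessian of a function symmetric.
-/
theorem gLow_mul_nonlinConn_sub (hf : IsFinslerOn O f)
    (h : (x, v) ∈ O ×ˢ ({0}ᶜ : Set (Model n))) (k m : Fin n) :
    ∑ i, gLow f m i x v * nonlinConn f i k x v - ∑ i, gLow f k i x v * nonlinConn f i m x v =
      pdx k (covec f m) x v - pdx m (covec f k) x v := by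
  have h1 := hf.sprayDeriv_gLow_aux h k m
  have h2 := hf.sprayDeriv_gLow_aux h m k
  rw [hf.sprayDeriv_gLow_symm h m k] at h2
  linarith

/-- This is Euler's identity for the 2-homogeneous `G`, obtained without proving homogeneity:
contract `sprayDeriv_gLow_aux` with `vᵏ`, where the Cartan terms vanish, compare with the
Euler–Lagrange equation, and cancel the invertible `g`. -/
theorem sum_nonlinConn_mul_coord (hf : IsFinslerOn O f)
    (h : (x, v) ∈ O ×ˢ ({0}ᶜ : Set (Model n))) (i : Fin n) :
    ∑ k, nonlinConn f i k x v * v k = spray f i x v := by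
  have key : ∀ m, ∑ i, gLow f m i x v * ∑ k, nonlinConn f i k x v * v k =
      ∑ i, gLow f m i x v * spray f i x v := by
    intro m
    have h1 : ∑ k, v k * sprayDeriv f (gLow f k m) x v =
        ∑ j, v j * pdx j (covec f m) x v := by
      have e1 : ∑ k, v k * ∑ j, v j * pdx j (gLow f k m) x v =
          ∑ j, v j * pdx j (covec f m) x v := by
        simp_rw [Finset.mul_sum]
        rw [Finset.sum_comm]
        refine Finset.sum_congr rfl fun j _ => ?_
        rw [← hf.sum_coord_mul_pdx_gLow h, Finset.mul_sum]
        refine Finset.sum_congr rfl fun k _ => ?_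
        rw [hf.pdx_gLow_symm h]
        ring
      have e2 : ∑ k, v k * ∑ j, spray f j x v * pdv j (gLow f k m) x v = 0 := by
        simp_rw [Finset.mul_sum]
        rw [Finset.sum_comm]
        refine Finset.sum_eq_zero fun j _ => ?_
        have := hf.sum_coord_mul_pdv_gLow h j m
        calc _ = spray f j x v * ∑ k, v k * pdv j (gLow f m k) x v := by
              rw [Finset.mul_sum]
              refine Finset.sum_congr rfl fun k _ => ?_
              rw [pdv_congr hf.isOpen_prod (fun _ _ h => hf.gLow_symm h k m) h]
              ring
          _ = 0 := by rw [this, mul_zero]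
      simp only [sprayDeriv, mul_sub, Finset.sum_sub_distrib]
      rw [e1, e2, sub_zero]
    have h2 : ∑ k, v k * sprayDeriv f (gLow f k m) x v =
        2 * (∑ i, gLow f m i x v * ∑ k, nonlinConn f i k x v * v k)
          - ∑ j, v j * pdx j (covec f m) x v + 2 * pdx m (energy f) x v := by
      rw [← hf.sum_coord_mul_pdx_covec h m]
      have e3 : 2 * (∑ i, gLow f m i x v * ∑ k, nonlinConn f i k x v * v k) =
          ∑ k, v k * (2 * ∑ i, gLow f m i x v * nonlinConn f i k x v) := by
        simp_rw [Finset.mul_sum]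
        rw [Finset.sum_comm]
        exact Finset.sum_congr rfl fun k _ => Finset.sum_congr rfl fun i _ => by ring
      rw [e3, ← Finset.sum_sub_distrib, ← Finset.sum_add_distrib]
      refine Finset.sum_congr rfl fun k _ => ?_
      rw [hf.sprayDeriv_gLow_aux h]
      ring
    rw [hf.sum_gLow_mul_spray h]
    linarith
  have hinj := Matrix.mulVec_injective_of_isUnit
    ((Matrix.isUnit_iff_isUnit_det _).2 (hf.isUnit_det h))
  have := hinj (a₁ := fun i => ∑ k, nonlinConn f i k x v * v k) (a₂ := fun i => spray f i x v)
    (funext key)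
  exact congrFun this i

/-- The energy is horizontally constant. -/
theorem pdx_energy (hf : IsFinslerOn O f)
    (h : (x, v) ∈ O ×ˢ ({0}ᶜ : Set (Model n))) (l : Fin n) :
    pdx l (energy f) x v = ∑ j, nonlinConn f j l x v * covec f j x v := by
  -- The antisymmetric identity is contracted with `vᵏ`; one half becomes `g G` by
  -- `sum_nonlinConn_mul_coord` and is removed with the Euler–Lagrange equation.
  have h1 : ∑ k, v k * (∑ i, gLow f k i x v * nonlinConn f i l x v
      - ∑ i, gLow f l i x v * nonlinConn f i k x v) =
      ∑ k, v k * (pdx l (covec f k) x v - pdx k (covec f l) x v) :=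
    Finset.sum_congr rfl fun k _ => by rw [hf.gLow_mul_nonlinConn_sub h]
  simp only [mul_sub, Finset.sum_sub_distrib] at h1
  have e1 : ∑ k, v k * ∑ i, gLow f k i x v * nonlinConn f i l x v =
      ∑ j, nonlinConn f j l x v * covec f j x v := by
    simp_rw [Finset.mul_sum]
    rw [Finset.sum_comm]
    refine Finset.sum_congr rfl fun j _ => ?_
    rw [← hf.sum_coord_mul_gLow h, Finset.mul_sum]
    refine Finset.sum_congr rfl fun k _ => ?_
    rw [hf.gLow_symm h]
    ring
  have e2 : ∑ k, v k * ∑ i, gLow f l i x v * nonlinConn f i k x v =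
      ∑ i, gLow f l i x v * spray f i x v := by
    simp_rw [Finset.mul_sum]
    rw [Finset.sum_comm]
    refine Finset.sum_congr rfl fun j _ => ?_
    rw [← hf.sum_nonlinConn_mul_coord h, Finset.mul_sum]
    exact Finset.sum_congr rfl fun k _ => by ring
  rw [e1, e2, hf.sum_coord_mul_pdx_covec h, hf.sum_gLow_mul_spray h] at h1
  linarith

end IsFinslerOn

end

section

variable {n : ℕ}

/-! ### Partial derivatives of functions of position -/

/-- `∂φ/∂xⁱ`. -/
def pd (i : Fin n) (φ : Model n → ℝ) (x : Model n) : ℝ := fderiv ℝ φ x (basisVec i)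

section Partial

variable {O : Set (Model n)} {φ ψ : Model n → ℝ} {x : Model n}

theorem differentiableAt_of_contDiffOn (hO : IsOpen O) (hx : x ∈ O) (hφ : ContDiffOn ℝ ∞ φ O) :
    DifferentiableAt ℝ φ x :=
  (hφ.contDiffAt (hO.mem_nhds hx)).differentiableAt (by simp)

theorem contDiffOn_pd (hO : IsOpen O) (hφ : ContDiffOn ℝ ∞ φ O) (i : Fin n) :
    ContDiffOn ℝ ∞ (pd i φ) O :=
  (hφ.fderiv_of_isOpen hO (by simp)).clm_apply contDiffOn_const

theorem pd_congr (hO : IsOpen O) (h : ∀ x ∈ O, φ x = ψ x) (hx : x ∈ O) (i : Fin n) :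
    pd i φ x = pd i ψ x := by
  have : φ =ᶠ[nhds x] ψ := by filter_upwards [hO.mem_nhds hx] with y hy using h y hy
  simp [pd, this.fderiv_eq]

theorem pd_add (hO : IsOpen O) (hx : x ∈ O) (i : Fin n) (hφ : ContDiffOn ℝ ∞ φ O)
    (hψ : ContDiffOn ℝ ∞ ψ O) : pd i (fun y => φ y + ψ y) x = pd i φ x + pd i ψ x := by
  simp [pd, fderiv_fun_add (differentiableAt_of_contDiffOn hO hx hφ)
    (differentiableAt_of_contDiffOn hO hx hψ)]

theorem pd_mul (hO : IsOpen O) (hx : x ∈ O) (i : Fin n) (hφ : ContDiffOn ℝ ∞ φ O)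
    (hψ : ContDiffOn ℝ ∞ ψ O) : pd i (fun y => φ y * ψ y) x = pd i φ x * ψ x + φ x * pd i ψ x := by
  simp [pd, fderiv_fun_mul (differentiableAt_of_contDiffOn hO hx hφ)
    (differentiableAt_of_contDiffOn hO hx hψ)]
  ring

theorem pd_sum (hO : IsOpen O) (hx : x ∈ O) (i : Fin n) {ι : Type*} {s : Finset ι}
    {χ : ι → Model n → ℝ} (hχ : ∀ j ∈ s, ContDiffOn ℝ ∞ (χ j) O) :
    pd i (fun y => ∑ j ∈ s, χ j y) x = ∑ j ∈ s, pd i (χ j) x := by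
  simp only [pd]
  rw [fderiv_fun_sum fun j hj => differentiableAt_of_contDiffOn hO hx (hχ j hj)]
  simp

theorem pd_comm (hO : IsOpen O) (hx : x ∈ O) (hφ : ContDiffOn ℝ ∞ φ O) (i j : Fin n) :
    pd i (pd j φ) x = pd j (pd i φ) x := by
  have hs := (hφ.contDiffAt (hO.mem_nhds hx)).isSymmSndFDerivAt
    (by simp; exact WithTop.coe_le_coe.mpr (mod_cast le_top))
  have hd : DifferentiableAt ℝ (fderiv ℝ φ) x :=
    ((hφ.fderiv_of_isOpen hO (m := 1) (by norm_cast)).contDiffAt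
      (hO.mem_nhds hx)).differentiableAt (by simp)
  have key : ∀ i j, pd i (pd j φ) x = fderiv ℝ (fderiv ℝ φ) x (basisVec i) (basisVec j) := by
    intro i j
    change fderiv ℝ (fun y => fderiv ℝ φ y (basisVec j)) x (basisVec i) = _
    rw [fderiv_clm_apply hd (differentiableAt_const _)]
    simp
  rw [key, key]
  exact hs _ _

end Partial

/-! ### Derivatives along vector fields and along geodesics -/

section Chain

variable {O : Set (Model n)} {Ω : Set (Model n × Model n)} {H : Model n → Model n → ℝ}
  {W : Model n → Model n} {x : Model n}

theorem contDiffOn_comp_field (hH : SmoothOn Ω H) (hW : ContDiffOn ℝ ∞ W O)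
    (hO : ∀ x ∈ O, (x, W x) ∈ Ω) : ContDiffOn ℝ ∞ (fun y => H y (W y)) O :=
  ContDiffOn.comp (g := fun q : Model n × Model n => H q.1 q.2) (f := fun y => (y, W y)) hH
    (contDiffOn_id.prodMk hW) hO

theorem contDiffOn_coord (hW : ContDiffOn ℝ ∞ W O) (i : Fin n) :
    ContDiffOn ℝ ∞ (fun y => W y i) O :=
  (EuclideanSpace.proj i : Model n →L[ℝ] ℝ).contDiff.comp_contDiffOn hW

theorem fderiv_coord (hW : DifferentiableAt ℝ W x) (i : Fin n) (a : Model n) :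
    fderiv ℝ (fun y => W y i) x a = fderiv ℝ W x a i := by
  have : HasFDerivAt (fun y => W y i) _ x :=
    (EuclideanSpace.proj i : Model n →L[ℝ] ℝ).hasFDerivAt.comp x hW.hasFDerivAt
  rw [this.fderiv]
  rfl

theorem pd_comp_field (hΩ : IsOpen Ω) (hH : SmoothOn Ω H) (hW : DifferentiableAt ℝ W x)
    (hx : (x, W x) ∈ Ω) (k : Fin n) :
    pd k (fun y => H y (W y)) x =
      pdx k H x (W x) + ∑ j, pd k (fun y => W y j) x * pdv j H x (W x) := by
  have h1 := (hH.differentiableAt hΩ hx).hasFDerivAt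
  have h2 : HasFDerivAt (fun y => (y, W y)) ((ContinuousLinearMap.id ℝ (Model n)).prod
    (fderiv ℝ W x)) x := (hasFDerivAt_id x).prodMk hW.hasFDerivAt
  have h3 : HasFDerivAt (fun y => H y (W y)) _ x :=
    HasFDerivAt.comp (g := fun q : Model n × Model n => H q.1 q.2) x h1 h2
  rw [pd, h3.fderiv]
  simp only [ContinuousLinearMap.comp_apply, ContinuousLinearMap.prod_apply,
    ContinuousLinearMap.id_apply]
  rw [fderiv_eq_sum_pd hH hΩ hx]
  congr 1
  · simp [basisVec_apply]
  · simp [pd, fderiv_coord hW]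

/-- The chain rule for a solution of `ẋ = w`, `ẇ = -G`; it reduces derivatives along geodesics to
the pointwise operator `sprayDeriv`. -/
theorem hasDerivAt_along_geodesic {f : Model n → Model n → ℝ} (hΩ : IsOpen Ω) (hH : SmoothOn Ω H)
    {c w : ℝ → Model n} {t : ℝ} (ht : (c t, w t) ∈ Ω) (hc : HasDerivAt c (w t) t)
    (hw : ∀ i, HasDerivAt (fun s => w s i) (-spray f i (c t) (w t)) t) :
    HasDerivAt (fun s => H (c s) (w s)) (sprayDeriv f H (c t) (w t)) t := by
  have hw' : HasDerivAt w (WithLp.toLp 2 fun i => -spray f i (c t) (w t)) t :=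
    (PiLp.continuousLinearEquiv 2 ℝ fun _ : Fin n => ℝ).symm.hasFDerivAt.comp_hasDerivAt t
      (hasDerivAt_pi.2 hw)
  have h1 := (hH.differentiableAt hΩ ht).hasFDerivAt
  have h3 : HasDerivAt (fun s => H (c s) (w s)) _ t :=
    HasFDerivAt.comp_hasDerivAt (l := fun q : Model n × Model n => H q.1 q.2) t h1
      (hc.prodMk hw')
  rw [fderiv_eq_sum_pd hH hΩ ht] at h3
  refine h3.congr_deriv ?_
  simp [sprayDeriv, sub_eq_add_neg]

end Chain

/-- The first derivative along the geodesic flow of the weight function. -/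
def weightFlow (f : Model n → Model n → ℝ) (Φ : Model n → ℝ) (x v : Model n) : ℝ :=
  ∑ i, nonlinConn f i i x v - ∑ j, v j * pd j Φ x

theorem smoothOn_of_contDiffOn {O : Set (Model n)} {φ : Model n → ℝ} (hφ : ContDiffOn ℝ ∞ φ O) :
    SmoothOn (O ×ˢ ({0}ᶜ : Set (Model n))) fun x _ => φ x :=
  hφ.comp contDiffOn_fst fun _ hq => hq.1

namespace IsFinslerOn

variable {O : Set (Model n)} {f : Model n → Model n → ℝ} {x v : Model n}

theorem mono (hf : IsFinslerOn O f) {O' : Set (Model n)} (hO' : IsOpen O') (h : O' ⊆ O) :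
    IsFinslerOn O' f where
  isOpen := hO'
  smooth := ContDiffOn.mono hf.smooth (Set.prod_mono h le_rfl)
  minkowski x hx := hf.minkowski x (h hx)

theorem sprayDeriv_eq_fderiv {H : Model n → Model n → ℝ} (hf : IsFinslerOn O f)
    (hH : SmoothOn (O ×ˢ {0}ᶜ) H) (h : (x, v) ∈ O ×ˢ ({0}ᶜ : Set (Model n))) :
    sprayDeriv f H x v = fderiv ℝ (fun q : Model n × Model n => H q.1 q.2) (x, v)
      (v, WithLp.toLp 2 fun j => -spray f j x v) := by
  rw [fderiv_eq_sum_pd hH hf.isOpen_prod h]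
  simp [sprayDeriv, sub_eq_add_neg]

/-- The logarithm of the Riemannian density. -/
theorem smooth_log_sqrt_det (hf : IsFinslerOn O f) :
    SmoothOn (O ×ˢ {0}ᶜ) fun x v => Real.log (Real.sqrt (gMatrix (f x) v).det) := by
  have hpos : ∀ q ∈ O ×ˢ ({0}ᶜ : Set (Model n)), 0 < (gMatrix (f q.1) q.2).det := fun q hq =>
    ((hf.minkowski q.1 hq.1).gMatrix_posDef hq.2).det_pos
  have hdet := SmoothOn.det (A := fun x v => gMatrix (f x) v) hf.smooth_gLow
  exact ContDiffOn.log (ContDiffOn.sqrt hdet fun q hq => (hpos q hq).ne')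
    fun q hq => (Real.sqrt_pos.2 (hpos q hq)).ne'

/-- By Jacobi's formula the left side is `½ tr(g⁻¹ ġ)`, and `ġ = g N + (g N)ᵀ` because the metric is
parallel; each summand contributes `½ tr N`. -/
theorem sprayDeriv_log_sqrt_det (hf : IsFinslerOn O f)
    (h : (x, v) ∈ O ×ˢ ({0}ᶜ : Set (Model n))) :
    sprayDeriv f (fun x v => Real.log (Real.sqrt (gMatrix (f x) v).det)) x v =
      ∑ i, nonlinConn f i i x v := by
  set g := gMatrix (f x) v with hg
  have hpd := (hf.minkowski x h.1).gMatrix_posDef h.2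
  have hdpos : 0 < g.det := hpd.det_pos
  rw [hf.sprayDeriv_eq_fderiv hf.smooth_log_sqrt_det h]
  set a : Model n × Model n := (v, WithLp.toLp 2 fun j => -spray f j x v) with ha
  have hd := hasFDerivAt_det (B := fun q : Model n × Model n => gMatrix (f q.1) q.2) (y := (x, v))
    fun i j => ((hf.smooth_gLow i j).differentiableAt hf.isOpen_prod h).hasFDerivAt
  have hl : HasFDerivAt (fun q : Model n × Model n =>
      Real.log (Real.sqrt (gMatrix (f q.1) q.2).det)) _ (x, v) :=
    (hd.sqrt hdpos.ne').log (Real.sqrt_pos.2 hdpos).ne'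
  let N : Matrix (Fin n) (Fin n) ℝ := Matrix.of fun i j => nonlinConn f i j x v
  have hgt : g.transpose = g := by
    ext i j
    exact hf.gLow_symm h j i
  have hsum : ∑ i, ∑ j, g.adjugate j i *
      fderiv ℝ (fun q : Model n × Model n => gLow f i j q.1 q.2) (x, v) a =
      2 * (g.det * N.trace) := by
    have e1 : ∀ i j, fderiv ℝ (fun q : Model n × Model n => gLow f i j q.1 q.2) (x, v) a =
        ((g * N).transpose + g * N) i j := by
      intro i j
      rw [ha, ← hf.sprayDeriv_eq_fderiv (hf.smooth_gLow i j) h, hf.sprayDeriv_gLow h]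
      rfl
    have e2 : ∀ M : Matrix (Fin n) (Fin n) ℝ,
        ∑ i, ∑ j, g.adjugate j i * M i j = (g.adjugate * M).trace := by
      intro M
      rw [Finset.sum_comm]
      rfl
    have e3 : (g.adjugate * (g * N)).trace = g.det * N.trace := by
      rw [← Matrix.mul_assoc, Matrix.adjugate_mul, Matrix.smul_mul, Matrix.one_mul,
        Matrix.trace_smul, smul_eq_mul]
    have e4 : (g.adjugate * (g * N).transpose).trace = g.det * N.trace := by
      have hat : g.adjugate.transpose = g.adjugate := by rw [Matrix.adjugate_transpose, hgt]
      rw [← Matrix.trace_transpose, Matrix.transpose_mul, Matrix.transpose_transpose, hat,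
        Matrix.trace_mul_comm, e3]
    simp_rw [e1]
    rw [e2, Matrix.mul_add, Matrix.trace_add, e3, e4]
    ring
  rw [hl.fderiv]
  simp only [smul_apply, FunLike.coe_sum, Finset.sum_apply, smul_eq_mul]
  rw [← hg]
  change (Real.sqrt g.det)⁻¹ * (1 / (2 * Real.sqrt g.det) * ∑ i, ∑ j, g.adjugate j i *
      fderiv ℝ (fun q : Model n × Model n => gLow f i j q.1 q.2) (x, v) a) = N.trace
  rw [hsum]
  have hs := Real.mul_self_sqrt hdpos.le
  have hs0 := (Real.sqrt_pos.2 hdpos).ne'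
  field_simp
  rw [sq, hs]

theorem smooth_weightCoord (hf : IsFinslerOn O f) {Φ : Model n → ℝ} (hΦ : ContDiffOn ℝ ∞ Φ O) :
    SmoothOn (O ×ˢ {0}ᶜ) (weightCoord f Φ) :=
  hf.smooth_log_sqrt_det.sub (smoothOn_of_contDiffOn hΦ)

theorem smooth_weightFlow (hf : IsFinslerOn O f) {Φ : Model n → ℝ} (hΦ : ContDiffOn ℝ ∞ Φ O) :
    SmoothOn (O ×ˢ {0}ᶜ) (weightFlow f Φ) :=
  (SmoothOn.sum fun i _ => hf.smooth_nonlinConn i i).sub (SmoothOn.sum fun j _ =>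
    (SmoothOn.coord j).mul (smoothOn_of_contDiffOn (contDiffOn_pd hf.isOpen hΦ j)))

theorem sprayDeriv_sub {H H' : Model n → Model n → ℝ} (hf : IsFinslerOn O f)
    (hH : SmoothOn (O ×ˢ {0}ᶜ) H) (hH' : SmoothOn (O ×ˢ {0}ᶜ) H')
    (h : (x, v) ∈ O ×ˢ ({0}ᶜ : Set (Model n))) :
    sprayDeriv f (fun x v => H x v - H' x v) x v = sprayDeriv f H x v - sprayDeriv f H' x v := by
  simp only [sprayDeriv, pdx_sub hf.isOpen_prod h _ hH hH', pdv_sub hf.isOpen_prod h _ hH hH',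
    mul_sub, Finset.sum_sub_distrib]
  ring

theorem sprayDeriv_weightCoord (hf : IsFinslerOn O f) {Φ : Model n → ℝ} (hΦ : ContDiffOn ℝ ∞ Φ O)
    (h : (x, v) ∈ O ×ˢ ({0}ᶜ : Set (Model n))) :
    sprayDeriv f (weightCoord f Φ) x v = weightFlow f Φ x v := by
  have := hf.sprayDeriv_sub hf.smooth_log_sqrt_det (smoothOn_of_contDiffOn hΦ) h
  rw [hf.sprayDeriv_log_sqrt_det h] at this
  refine this.trans ?_
  simp [sprayDeriv, weightFlow, pdx, pdv, pd]

/-- Expanded so that the first two sums are exactly the derivatives of `N` occurring with opposite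
sign in `ricciCoord`. -/
theorem sprayDeriv_weightFlow (hf : IsFinslerOn O f) {Φ : Model n → ℝ} (hΦ : ContDiffOn ℝ ∞ Φ O)
    (h : (x, v) ∈ O ×ˢ ({0}ᶜ : Set (Model n))) :
    sprayDeriv f (weightFlow f Φ) x v =
      ∑ i, ∑ j, v j * pdx j (nonlinConn f i i) x v
        - ∑ i, ∑ j, spray f j x v * pdv j (nonlinConn f i i) x v
        - ∑ i, ∑ j, v i * (v j * pd i (pd j Φ) x) + ∑ j, spray f j x v * pd j Φ x := by
  have hN := fun i => hf.smooth_nonlinConn i i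
  have hp : ∀ j, SmoothOn (O ×ˢ ({0}ᶜ : Set (Model n))) fun x _ => pd j Φ x :=
    fun j => smoothOn_of_contDiffOn (contDiffOn_pd hf.isOpen hΦ j)
  have h1 := hf.sprayDeriv_sub (SmoothOn.sum (s := Finset.univ) fun i _ => hN i)
    (SmoothOn.sum (s := Finset.univ) fun j _ => (SmoothOn.coord j).mul (hp j)) h
  refine Eq.trans h1 ?_
  have e1 : sprayDeriv f (fun x v => ∑ i, nonlinConn f i i x v) x v =
      ∑ i, ∑ j, v j * pdx j (nonlinConn f i i) x v
        - ∑ i, ∑ j, spray f j x v * pdv j (nonlinConn f i i) x v := by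
    simp only [sprayDeriv, pdx_sum hf.isOpen_prod h _ fun i _ => hN i,
      pdv_sum hf.isOpen_prod h _ fun i _ => hN i, Finset.mul_sum]
    exact congrArg₂ (· - ·) Finset.sum_comm Finset.sum_comm
  have e2 : sprayDeriv f (fun x v => ∑ j, v j * pd j Φ x) x v =
      ∑ i, ∑ j, v i * (v j * pd i (pd j Φ) x) - ∑ j, spray f j x v * pd j Φ x := by
    simp only [sprayDeriv, pdx_sum_coord_mul hf.isOpen_prod h _ hp,
      pdv_sum_coord_mul hf.isOpen_prod h _ hp, Finset.mul_sum]
    congr 1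
    refine Finset.sum_congr rfl fun j _ => ?_
    simp [pdv]
  rw [e1, e2]
  ring

end IsFinslerOn

end

section

variable {n : ℕ}

/-! ### The Bochner identity in coordinates -/

/-- The covariant derivative `∂Wⁱ/∂xʲ + Nⁱ_j(W)` of a vector field with reference vector `W`. -/
def covDeriv (f : Model n → Model n → ℝ) (W : Model n → Model n) (x : Model n) :
    Matrix (Fin n) (Fin n) ℝ :=
  Matrix.of fun i j => pd j (fun y => W y i) x + nonlinConn f i j x (W x)

/-- The divergence with respect to the measure `e^Φ dx`. -/
def coordDiv (Φ : Model n → ℝ) (W : Model n → Model n) (x : Model n) : ℝ :=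
  ∑ i, (pd i (fun y => W y i) x + W x i * pd i Φ x)

/-- The acceleration `D_W W` of a vector field. -/
def accel (f : Model n → Model n → ℝ) (W : Model n → Model n) (x : Model n) : Model n :=
  WithLp.toLp 2 ((covDeriv f W x).mulVec (W x).ofLp)

namespace IsFinslerOn

variable {O : Set (Model n)} {f : Model n → Model n → ℝ} {W : Model n → Model n} {x : Model n}

theorem differentiableAt_field (hf : IsFinslerOn O f) (hW : ContDiffOn ℝ ∞ W O) (hx : x ∈ O) :
    DifferentiableAt ℝ W x :=
  (hW.contDiffAt (hf.isOpen.mem_nhds hx)).differentiableAt (by simp)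

/-- The Hessian of a function is symmetric. -/
theorem gMatrix_mul_covDeriv_symm (hf : IsFinslerOn O f) (hW : ContDiffOn ℝ ∞ W O)
    (hW0 : ∀ x ∈ O, W x ≠ 0) {U : Model n → ℝ} (hU : ContDiffOn ℝ ∞ U O)
    (hUW : ∀ x ∈ O, ∀ i, covec f i x (W x) = pd i U x) (hx : x ∈ O) :
    (gMatrix (f x) (W x) * covDeriv f W x).transpose = gMatrix (f x) (W x) * covDeriv f W x := by
  have hm : (x, W x) ∈ O ×ˢ ({0}ᶜ : Set (Model n)) := ⟨hx, hW0 x hx⟩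
  have hd := hf.differentiableAt_field hW hx
  -- Differentiate `∂U/∂xᵏ = covec(x, W(x))`. Equality of the mixed derivatives of `U` leaves an
  -- asymmetry from the explicit dependence on `x`, which `gLow_mul_nonlinConn_sub` compensates.
  have key : ∀ k l, pd l (pd k U) x =
      pdx l (covec f k) x (W x) + ∑ j, gLow f k j x (W x) * pd l (fun y => W y j) x := by
    intro k l
    rw [← pd_congr hf.isOpen (fun x hx => hUW x hx k) hx,
      pd_comp_field hf.isOpen_prod (hf.smooth_covec k) hd hm]
    congr 1
    refine Finset.sum_congr rfl fun j _ => ?_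
    rw [hf.gLow_symm hm, gLow_eq, mul_comm]
  have hent : ∀ k l, (gMatrix (f x) (W x) * covDeriv f W x) k l =
      ∑ j, gLow f k j x (W x) * pd l (fun y => W y j) x +
        ∑ j, gLow f k j x (W x) * nonlinConn f j l x (W x) := by
    intro k l
    rw [Matrix.mul_apply, ← Finset.sum_add_distrib]
    exact Finset.sum_congr rfl fun j _ => mul_add _ _ _
  ext l k
  rw [Matrix.transpose_apply, hent, hent]
  have h1 := hf.gLow_mul_nonlinConn_sub hm l k
  have h2 := pd_comm hf.isOpen hx hU l k
  rw [key, key] at h2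
  linarith

/-- The energy is horizontally constant, so only the covariant derivative of `W` contributes. -/
theorem pd_energy_field (hf : IsFinslerOn O f) (hW : ContDiffOn ℝ ∞ W O)
    (hW0 : ∀ x ∈ O, W x ≠ 0) (hx : x ∈ O) (l : Fin n) :
    pd l (fun y => energy f y (W y)) x = ∑ k, covec f k x (W x) * covDeriv f W x k l := by
  have hm : (x, W x) ∈ O ×ˢ ({0}ᶜ : Set (Model n)) := ⟨hx, hW0 x hx⟩
  rw [pd_comp_field hf.isOpen_prod hf.smooth_energy (hf.differentiableAt_field hW hx) hm,
    hf.pdx_energy hm, ← Finset.sum_add_distrib]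
  refine Finset.sum_congr rfl fun k _ => ?_
  simp only [covDeriv, Matrix.of_apply, covec]
  ring

open Matrix in
/-- The gradient of the energy of a gradient vector field is its acceleration. -/
theorem halfHess_accel (hf : IsFinslerOn O f) (hW : ContDiffOn ℝ ∞ W O)
    (hW0 : ∀ x ∈ O, W x ≠ 0) {U : Model n → ℝ} (hU : ContDiffOn ℝ ∞ U O)
    (hUW : ∀ x ∈ O, ∀ i, covec f i x (W x) = pd i U x) (hx : x ∈ O) (b : Model n) :
    halfHess (f x) (W x) (accel f W x) b = fderiv ℝ (fun y => energy f y (W y)) x b := by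
  have hm : (x, W x) ∈ O ×ˢ ({0}ᶜ : Set (Model n)) := ⟨hx, hW0 x hx⟩
  have hsymm := hf.gMatrix_mul_covDeriv_symm hW hW0 hU hUW hx
  have hg : (gMatrix (f x) (W x))ᵀ = gMatrix (f x) (W x) := by
    ext i j
    exact hf.gLow_symm hm j i
  rw [(hf.minkowski x hx).halfHess_eq_dotProduct (hW0 x hx), map_eq_sum_basisVec]
  rw [Matrix.transpose_mul, hg] at hsymm
  -- Symmetry of `g A` gives `g(AW, b) = g(W, Ab)`; then `g(W, ·)` is the momentum of `W`, and
  -- `pd_energy_field` applies.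
  have h1 : (accel f W x).ofLp ⬝ᵥ (gMatrix (f x) (W x) *ᵥ b.ofLp) =
      (W x).ofLp ⬝ᵥ ((gMatrix (f x) (W x)) *ᵥ (covDeriv f W x *ᵥ b.ofLp)) := by
    rw [show (accel f W x).ofLp = (W x).ofLp ᵥ* (covDeriv f W x)ᵀ from
        (Matrix.vecMul_transpose (covDeriv f W x) (W x).ofLp).symm, ← Matrix.dotProduct_mulVec,
      Matrix.mulVec_mulVec, Matrix.mulVec_mulVec, hsymm]
  have h2 : ∀ k, ((W x).ofLp ᵥ* gMatrix (f x) (W x)) k = covec f k x (W x) := by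
    intro k
    rw [← hf.sum_coord_mul_gLow hm]
    simp only [Matrix.vecMul, dotProduct]
    refine Finset.sum_congr rfl fun j _ => ?_
    rw [hf.gLow_symm hm]
    rfl
  rw [h1, Matrix.dotProduct_mulVec, funext h2]
  simp only [dotProduct, Matrix.mulVec, Finset.mul_sum]
  rw [Finset.sum_comm]
  refine Finset.sum_congr rfl fun l _ => ?_
  have := hf.pd_energy_field hW hW0 hx l
  rw [pd] at this
  rw [this, Finset.mul_sum]
  exact Finset.sum_congr rfl fun k _ => by ring

/-- Since `N v = G`, the acceleration involves only the spray, and its divergence contains no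
derivative of `N`. -/
theorem accel_apply (hf : IsFinslerOn O f) (hW0 : ∀ x ∈ O, W x ≠ 0) (hx : x ∈ O) (i : Fin n) :
    accel f W x i = ∑ j, W x j * pd j (fun y => W y i) x + spray f i x (W x) := by
  have hm : (x, W x) ∈ O ×ˢ ({0}ᶜ : Set (Model n)) := ⟨hx, hW0 x hx⟩
  rw [← hf.sum_nonlinConn_mul_coord hm, ← Finset.sum_add_distrib]
  simp only [accel, Matrix.mulVec, dotProduct]
  refine Finset.sum_congr rfl fun j _ => ?_
  simp only [covDeriv, Matrix.of_apply]
  ring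

theorem contDiffOn_coordDiv (hO : IsOpen O) {Φ : Model n → ℝ} (hΦ : ContDiffOn ℝ ∞ Φ O)
    (hW : ContDiffOn ℝ ∞ W O) : ContDiffOn ℝ ∞ (coordDiv Φ W) O :=
  ContDiffOn.sum fun i _ => (contDiffOn_pd hO (contDiffOn_coord hW i) i).add
    ((contDiffOn_coord hW i).mul (contDiffOn_pd hO hΦ i))

theorem pd_coordDiv (hO : IsOpen O) {Φ : Model n → ℝ} (hΦ : ContDiffOn ℝ ∞ Φ O)
    (hW : ContDiffOn ℝ ∞ W O) (hx : x ∈ O) (k : Fin n) :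
    pd k (coordDiv Φ W) x = ∑ i, (pd k (pd i fun y => W y i) x +
      (pd k (fun y => W y i) x * pd i Φ x + W x i * pd k (pd i Φ) x)) := by
  have h1 := fun i => contDiffOn_pd hO (contDiffOn_coord hW i) i
  have h2 := fun i => contDiffOn_pd hO hΦ i
  have h3 := fun i => contDiffOn_coord hW i
  refine (pd_sum hO hx k fun i _ => (h1 i).add ((h3 i).mul (h2 i))).trans ?_
  refine Finset.sum_congr rfl fun i _ => ?_
  rw [pd_add hO hx k (h1 i) ((h3 i).mul (h2 i)), pd_mul hO hx k (h3 i) (h2 i)]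

theorem pd_accel (hf : IsFinslerOn O f) (hW : ContDiffOn ℝ ∞ W O)
    (hW0 : ∀ x ∈ O, W x ≠ 0) (hx : x ∈ O) (i : Fin n) :
    pd i (fun y => accel f W y i) x =
      ∑ j, (pd i (fun y => W y j) x * pd j (fun y => W y i) x
        + W x j * pd j (pd i fun y => W y i) x)
      + (pdx i (spray f i) x (W x)
        + ∑ j, pd i (fun y => W y j) x * (2 * nonlinConn f i j x (W x))) := by
  have hO := hf.isOpen
  have hm : (x, W x) ∈ O ×ˢ ({0}ᶜ : Set (Model n)) := ⟨hx, hW0 x hx⟩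
  have h3 := fun i => contDiffOn_coord hW i
  have h1 := fun i j => contDiffOn_pd hO (h3 i) j
  rw [pd_congr hO (fun y hy => hf.accel_apply hW0 hy i) hx,
    pd_add hO hx i (ContDiffOn.sum fun j _ => (h3 j).mul (h1 i j))
      (contDiffOn_comp_field (hf.smooth_spray i) hW fun x hx => ⟨hx, hW0 x hx⟩),
    pd_sum hO hx i fun j _ => (h3 j).mul (h1 i j),
    pd_comp_field hf.isOpen_prod (hf.smooth_spray i) (hf.differentiableAt_field hW hx) hm]
  congr 1
  · refine Finset.sum_congr rfl fun j _ => ?_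
    rw [pd_mul hO hx i (h3 j) (h1 i j), pd_comm hO hx (h3 i)]
  · simp only [pdv_spray]

theorem trace_covDeriv_sq (f : Model n → Model n → ℝ) (W : Model n → Model n) (x : Model n) :
    (covDeriv f W x * covDeriv f W x).trace =
      ∑ i, ∑ j, pd i (fun y => W y j) x * pd j (fun y => W y i) x
      + ∑ i, ∑ j, pd i (fun y => W y j) x * (2 * nonlinConn f i j x (W x))
      + ∑ i, ∑ j, nonlinConn f i j x (W x) * nonlinConn f j i x (W x) := by
  have e : ∑ i, ∑ j, pd j (fun y => W y i) x * nonlinConn f j i x (W x) =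
      ∑ i, ∑ j, pd i (fun y => W y j) x * nonlinConn f i j x (W x) := Finset.sum_comm
  have e' : (covDeriv f W x * covDeriv f W x).trace =
      ∑ i, ∑ j, pd i (fun y => W y j) x * pd j (fun y => W y i) x
      + ∑ i, ∑ j, pd i (fun y => W y j) x * nonlinConn f i j x (W x)
      + ∑ i, ∑ j, pd j (fun y => W y i) x * nonlinConn f j i x (W x)
      + ∑ i, ∑ j, nonlinConn f i j x (W x) * nonlinConn f j i x (W x) := by
    simp only [Matrix.trace, Matrix.diag, Matrix.mul_apply, ← Finset.sum_add_distrib]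
    refine Finset.sum_congr rfl fun i _ => Finset.sum_congr rfl fun j _ => ?_
    simp only [covDeriv, Matrix.of_apply]
    ring
  have e'' : ∑ i, ∑ j, pd i (fun y => W y j) x * (2 * nonlinConn f i j x (W x)) =
      2 * ∑ i, ∑ j, pd i (fun y => W y j) x * nonlinConn f i j x (W x) := by
    simp only [Finset.mul_sum]
    exact Finset.sum_congr rfl fun i _ => Finset.sum_congr rfl fun j _ => by ring
  rw [e', e, e'']
  ring

/-- The Bochner–Weitzenböck identity in coordinates. -/
theorem coordDiv_accel_sub (hf : IsFinslerOn O f) {Φ : Model n → ℝ} (hΦ : ContDiffOn ℝ ∞ Φ O)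
    (hW : ContDiffOn ℝ ∞ W O) (hW0 : ∀ x ∈ O, W x ≠ 0) (hx : x ∈ O) :
    coordDiv Φ (accel f W) x - fderiv ℝ (coordDiv Φ W) x (W x) =
      (covDeriv f W x * covDeriv f W x).trace + ricciCoord f x (W x)
        + sprayDeriv f (weightFlow f Φ) x (W x) := by
  have hO := hf.isOpen
  have hm : (x, W x) ∈ O ×ˢ ({0}ᶜ : Set (Model n)) := ⟨hx, hW0 x hx⟩
  have hA : coordDiv Φ (accel f W) x =
      ∑ i, ∑ j, pd i (fun y => W y j) x * pd j (fun y => W y i) x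
      + ∑ i, ∑ j, W x j * pd j (pd i fun y => W y i) x
      + ∑ i, pdx i (spray f i) x (W x)
      + ∑ i, ∑ j, pd i (fun y => W y j) x * (2 * nonlinConn f i j x (W x))
      + ∑ i, ∑ j, W x j * pd j (fun y => W y i) x * pd i Φ x
      + ∑ i, spray f i x (W x) * pd i Φ x := by
    simp only [coordDiv, hf.pd_accel hW hW0 hx, hf.accel_apply hW0 hx, add_mul,
      Finset.sum_add_distrib, Finset.sum_mul]
    ring
  have hB : fderiv ℝ (coordDiv Φ W) x (W x) =
      ∑ i, ∑ j, W x j * pd j (pd i fun y => W y i) x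
      + ∑ i, ∑ j, W x j * pd j (fun y => W y i) x * pd i Φ x
      + ∑ i, ∑ j, W x i * (W x j * pd i (pd j Φ) x) := by
    rw [map_eq_sum_basisVec]
    change ∑ k, W x k * pd k (coordDiv Φ W) x = _
    simp only [pd_coordDiv hO hΦ hW hx, Finset.mul_sum, mul_add, Finset.sum_add_distrib]
    rw [Finset.sum_comm (f := fun i j => W x j * pd j (pd i fun y => W y i) x),
      Finset.sum_comm (f := fun i j => W x j * pd j (fun y => W y i) x * pd i Φ x)]
    simp only [mul_assoc]
    ring
  -- The second derivatives of `W` and the terms `W ∂W ∂Φ` cancel between `hA` and `hB`. On the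
  -- right, the products `N N` cancel between the trace and the Ricci curvature, the derivatives of
  -- `N` between the Ricci curvature and the weight term.
  rw [hA, hB, trace_covDeriv_sq, hf.sprayDeriv_weightFlow hΦ hm]
  simp only [ricciCoord, riemannCurv, Finset.sum_add_distrib, Finset.sum_sub_distrib]
  ring

end IsFinslerOn

end

section

variable {n : ℕ} {M : Type*} [TopologicalSpace M] [ChartedSpace (Model n) M]
  [IsManifold (𝓡 n) ∞ M]

/-! ### Passage to charts -/

section Chart

variable {e : OpenPartialHomeomorph M (Model n)}

theorem mdifferentiable_of_mem_atlas_model (he : e ∈ atlas (Model n) M) :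
    e.MDifferentiable (𝓡 n) (𝓡 n) := by
  have : IsManifold (𝓡 n) 1 M := IsManifold.of_le (n := ∞) (by exact_mod_cast le_top)
  exact mdifferentiable_of_mem_atlas he

/-- The differential of the inverse of a chart, as an isomorphism of `ℝⁿ` with the tangent space. -/
def chartDeriv (he : e ∈ atlas (Model n) M) {y : Model n} (hy : y ∈ e.target) :
    Model n ≃L[ℝ] Model n :=
  (mdifferentiable_of_mem_atlas_model he).symm.mfderiv (x := y) hy

/-- The differential `Du(x)` as a linear form on `ℝⁿ`. -/
def dform (φ : M → ℝ) (x : M) : Model n →L[ℝ] ℝ := differential φ x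

/-- `vecInChart` for vectors of `ℝⁿ`. -/
def toChart (e : OpenPartialHomeomorph M (Model n)) (x : M) (v : Model n) : Model n :=
  vecInChart e x v

theorem chartDeriv_symm_apply (he : e ∈ atlas (Model n) M) {y : Model n} (hy : y ∈ e.target)
    (a : Model n) : (chartDeriv he hy).symm a = toChart e (e.symm y) a := rfl

theorem dform_eq (he : e ∈ atlas (Model n) M) {φ : M → ℝ} {y : Model n} (hy : y ∈ e.target)
    (hφ : DifferentiableAt ℝ (φ ∘ e.symm) y) (a : Model n) :
    dform φ (e.symm y) a = fderiv ℝ (φ ∘ e.symm) y (toChart e (e.symm y) a) := by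
  have hz : e.symm y ∈ e.source := e.map_target hy
  have heq : φ =ᶠ[nhds (e.symm y)] (φ ∘ e.symm) ∘ e := by
    filter_upwards [e.open_source.mem_nhds hz] with z hz
    simp [e.left_inv hz]
  have h1 := (mdifferentiable_of_mem_atlas_model he).mdifferentiableAt hz
  have h2 : MDifferentiableAt (𝓡 n) 𝓘(ℝ, ℝ) (φ ∘ e.symm) (e (e.symm y)) := by
    rw [e.right_inv hy]
    exact hφ.mdifferentiableAt
  rw [dform, differential, heq.mfderiv_eq, mfderiv_comp _ h2 h1]
  simp only [mfderiv_eq_fderiv, e.right_inv hy]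
  rfl

theorem fderiv_comp_symm (he : e ∈ atlas (Model n) M) {φ : M → ℝ} {y : Model n}
    (hy : y ∈ e.target) (hφ : DifferentiableAt ℝ (φ ∘ e.symm) y) (a : Model n) :
    fderiv ℝ (φ ∘ e.symm) y a = dform φ (e.symm y) (chartDeriv he hy a) := by
  rw [dform_eq he hy hφ, ← chartDeriv_symm_apply he hy, ContinuousLinearEquiv.symm_apply_apply]

theorem contDiffOn_comp_symm (he : e ∈ atlas (Model n) M) {φ : M → ℝ}
    (hφ : ContMDiff (𝓡 n) 𝓘(ℝ, ℝ) ∞ φ) : ContDiffOn ℝ ∞ (φ ∘ e.symm) e.target := by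
  have h1 : ContMDiffOn (𝓡 n) (𝓡 n) ∞ e.symm e.target :=
    contMDiffOn_symm_of_mem_maximalAtlas (IsManifold.subset_maximalAtlas he)
  exact (hφ.comp_contMDiffOn h1).contDiffOn

end Chart

namespace FinslerStructure

variable (F : FinslerStructure n M) {e : OpenPartialHomeomorph M (Model n)}

/-- The Finsler norm of `TₓM` as a function on `ℝⁿ`. -/
def fibreNorm (x : M) : Model n → ℝ := F.toFun x

/-- The gradient at `x` as a vector of `ℝⁿ`. -/
def grad (u : M → ℝ) (x : M) : Model n := F.gradient u x

/-- The linearized gradient at `x` as a vector of `ℝⁿ`. -/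
def linGrad (u φ : M → ℝ) (x : M) : Model n := F.linGradient (F.gradient u) φ x

theorem inChart_eq (he : e ∈ atlas (Model n) M) {y : Model n} (hy : y ∈ e.target) :
    F.inChart e y = fun w => F.fibreNorm (e.symm y) (chartDeriv he hy w) := rfl

/-- The chart expression is `F` composed with the tangent map of `e.symm`, read on `ℝⁿ × ℝⁿ`. The
tangent map is smooth and injective on fibres, so nonzero vectors stay off the zero section. -/
theorem smooth_inChart (he : e ∈ atlas (Model n) M) :
    SmoothOn (e.target ×ˢ {0}ᶜ) (F.inChart e) := by
  have : IsManifold (𝓡 n) 1 M := IsManifold.of_le (n := ∞) (by exact_mod_cast le_top)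
  have h1 : ContMDiffOn (𝓡 n) (𝓡 n) ∞ e.symm e.target :=
    contMDiffOn_symm_of_mem_maximalAtlas (IsManifold.subset_maximalAtlas he)
  have h2 := h1.contMDiffOn_tangentMapWithin (m := ∞) (by simp) e.open_target.uniqueMDiffOn
  have h3 : ContMDiff (𝓡 n).tangent (𝓡 n).tangent ∞
      (tangentBundleModelSpaceHomeomorph (𝓡 n) (H := Model n)).symm :=
    contMDiff_tangentBundleModelSpaceHomeomorph_symm
  have hD : ∀ y ∈ e.target, mfderivWithin (𝓡 n) (𝓡 n) e.symm e.target y =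
      mfderiv (𝓡 n) (𝓡 n) e.symm y := fun y hy => mfderivWithin_of_isOpen e.open_target hy
  have h4 : ContMDiffOn (𝓡 n).tangent 𝓘(ℝ, ℝ) ∞
      (fun q : ModelProd (Model n) (Model n) => F.inChart e q.1 q.2)
      {q | q.1 ∈ e.target ∧ q.2 ≠ 0} := by
    let S : Set (TangentBundle (𝓡 n) (Model n)) := {p | p.1 ∈ e.target ∧ p.2 ≠ 0}
    have h5 : ContMDiffOn (𝓡 n).tangent 𝓘(ℝ, ℝ) ∞
        ((fun p : TangentBundle (𝓡 n) M => F.toFun p.1 p.2) ∘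
          tangentMapWithin (𝓡 n) (𝓡 n) e.symm e.target) S := by
      refine F.smooth.comp (h2.mono fun p hp => hp.1) fun p hp => ?_
      have : (mfderivWithin (𝓡 n) (𝓡 n) e.symm e.target p.1) p.2 ≠ 0 := by
        rw [hD p.1 hp.1]
        exact (chartDeriv he hp.1).map_ne_zero_iff.2 hp.2
      exact this
    refine (h5.comp h3.contMDiffOn fun q hq => hq).congr fun q hq => ?_
    change F.toFun (e.symm q.1) (mfderiv 𝓘(ℝ, Model n) (𝓡 n) e.symm q.1 q.2) =
      F.toFun (e.symm q.1) (mfderivWithin (𝓡 n) (𝓡 n) e.symm e.target q.1 q.2)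
    rw [hD q.1 hq.1]
  rw [SmoothOn, ← contMDiffOn_iff_contDiffOn, modelWithCornersSelf_prod]
  exact h4

/-- Smoothness on a single fibre is read off from the chart expression by freezing the base point
and undoing the linear isomorphism `chartDeriv`. -/
theorem isMinkowskiNorm (x : M) : IsMinkowskiNorm (F.fibreNorm x) where
  nonneg := F.nonneg x
  homogeneous := F.homogeneous x
  halfHess_pos := F.stronglyConvex x
  contDiffOn := by
    have he := chart_mem_atlas (Model n) x
    have hy := mem_chart_target (Model n) x
    have h1 := F.smooth_inChart he
    have h2 : ContDiffOn ℝ ∞ (F.inChart (chartAt (Model n) x) (chartAt (Model n) x x)) {0}ᶜ :=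
      ContDiffOn.comp (g := fun q : Model n × Model n => F.inChart (chartAt (Model n) x) q.1 q.2)
        (f := fun w => (chartAt (Model n) x x, w)) h1
        (contDiffOn_const.prodMk contDiffOn_id) fun w hw => ⟨hy, hw⟩
    have h3 := h2.comp (chartDeriv he hy).symm.contDiff.contDiffOn (s := {0}ᶜ)
      fun w hw => by simpa using hw
    refine h3.congr fun w _ => ?_
    rw [Function.comp_apply, F.inChart_eq he hy]
    simp only [ContinuousLinearEquiv.apply_symm_apply]
    rw [(chartAt (Model n) x).left_inv (mem_chart_source _ x)]

theorem isFinslerOn_inChart (he : e ∈ atlas (Model n) M) :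
    IsFinslerOn e.target (F.inChart e) where
  isOpen := e.open_target
  smooth := F.smooth_inChart he
  minkowski y hy := by
    rw [F.inChart_eq he hy]
    exact (F.isMinkowskiNorm (e.symm y)).comp (chartDeriv he hy)

/-- The existence half of `legendre_spec` makes the choice in `legendre` meaningful; the other half
replaces it by the momentum equation, which transforms well between charts. -/
theorem grad_spec {u : M → ℝ} {x : M} (hx : dform (n := n) u x ≠ 0) :
    F.grad u x ≠ 0 ∧ momentum (F.fibreNorm x) (F.grad u x) = dform u x := by
  have h := (F.isMinkowskiNorm x).legendre_spec hx rfl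
  have h1 := Classical.epsilon_spec h.1
  exact h.2 _ h1.1 h1.2

/-- The gradient vector field in a chart. -/
def gradInChart (e : OpenPartialHomeomorph M (Model n)) (u : M → ℝ) (y : Model n) : Model n :=
  toChart e (e.symm y) (F.grad u (e.symm y))

theorem chartDeriv_gradInChart (he : e ∈ atlas (Model n) M) {y : Model n} (hy : y ∈ e.target)
    (u : M → ℝ) : chartDeriv he hy (F.gradInChart e u y) = F.grad u (e.symm y) :=
  (chartDeriv he hy).apply_symm_apply _

theorem inChart_gradInChart (he : e ∈ atlas (Model n) M) {y : Model n} (hy : y ∈ e.target)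
    (u : M → ℝ) :
    F.inChart e y (F.gradInChart e u y) = F.fibreNorm (e.symm y) (F.grad u (e.symm y)) := by
  simp only [F.inChart_eq he hy, F.chartDeriv_gradInChart he hy]

theorem gradInChart_spec (he : e ∈ atlas (Model n) M) {y : Model n} (hy : y ∈ e.target)
    {u : M → ℝ} (hu : DifferentiableAt ℝ (u ∘ e.symm) y) (h0 : fderiv ℝ (u ∘ e.symm) y ≠ 0) :
    F.gradInChart e u y ≠ 0 ∧
      momentum (F.inChart e y) (F.gradInChart e u y) = fderiv ℝ (u ∘ e.symm) y := by
  have hd : dform (n := n) u (e.symm y) ≠ 0 := by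
    intro h
    refine h0 (ContinuousLinearMap.ext fun a => ?_)
    rw [fderiv_comp_symm he hy hu, h]
    rfl
  obtain ⟨h1, h2⟩ := F.grad_spec hd
  refine ⟨?_, ContinuousLinearMap.ext fun a => ?_⟩
  · exact (chartDeriv he hy).symm.map_ne_zero_iff.2 h1
  · rw [F.inChart_eq he hy, fderiv_comp_symm he hy hu, momentum_comp,
      F.chartDeriv_gradInChart he hy, h2]

-- Since `g g⁻¹ = 1`, the linearized gradient represents `dφ` with respect to `g`. Unlike the
-- coordinate formula in the definition, this description makes sense in every chart.
open Matrix in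
theorem halfHess_linGrad {u : M → ℝ} {x : M} (hV : F.grad u x ≠ 0) (φ : M → ℝ) (b : Model n) :
    halfHess (F.fibreNorm x) (F.grad u x) (F.linGrad u φ x) b = dform φ x b := by
  have hf := F.isMinkowskiNorm x
  set g := gMatrix (F.fibreNorm x) (F.grad u x) with hg
  have hpd : g.PosDef := hf.gMatrix_posDef hV
  have hgt : gᵀ = g := by
    ext i j
    exact hf.gMatrix_symm hV j i
  have hX : (F.linGrad u φ x).ofLp = g⁻¹ *ᵥ fun j => dform φ x (basisVec j) := by
    ext i
    change (∑ i : Fin n, (∑ j : Fin n, g⁻¹ i j * dform φ x (basisVec j)) •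
      (basisVec i : Model n)) i = _
    simp [basisVec_apply, Matrix.mulVec, dotProduct]
  rw [hf.halfHess_eq_dotProduct hV, hX, ← Matrix.vecMul_transpose g⁻¹, ← Matrix.dotProduct_mulVec,
    Matrix.mulVec_mulVec, Matrix.transpose_nonsing_inv, hgt, ← hg,
    Matrix.nonsing_inv_mul _ (isUnit_iff_ne_zero.2 hpd.det_pos.ne'),
    Matrix.one_mulVec, map_eq_sum_basisVec]
  exact Finset.sum_congr rfl fun i _ => mul_comm _ _

theorem halfHess_linGrad_inChart (he : e ∈ atlas (Model n) M) {y : Model n}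
    (hy : y ∈ e.target) {u φ : M → ℝ} (hV : F.gradInChart e u y ≠ 0)
    (hφ : DifferentiableAt ℝ (φ ∘ e.symm) y) (b : Model n) :
    halfHess (F.inChart e y) (F.gradInChart e u y)
      (toChart e (e.symm y) (F.linGrad u φ (e.symm y))) b = fderiv ℝ (φ ∘ e.symm) y b := by
  have hV' : F.grad u (e.symm y) ≠ 0 := by
    rw [← F.chartDeriv_gradInChart he hy]
    exact (chartDeriv he hy).map_ne_zero_iff.2 hV
  rw [F.inChart_eq he hy, fderiv_comp_symm he hy hφ, halfHess_comp,
    F.chartDeriv_gradInChart he hy, ← chartDeriv_symm_apply he hy,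
    ContinuousLinearEquiv.apply_symm_apply, F.halfHess_linGrad hV']

end FinslerStructure

end

section

variable {n : ℕ}

/-! ### Smoothness of the gradient -/

theorem isInvertible_of_injective {l : Model n →L[ℝ] Model n} (hl : Function.Injective l) :
    l.IsInvertible :=
  ⟨(LinearEquiv.ofInjectiveEndo (l : Model n →ₗ[ℝ] Model n) hl).toContinuousLinearEquiv, by
    ext a
    rfl⟩

/-- The implicit function theorem for `momentum - dU = 0`, whose derivative in the velocity is the
nondegenerate `g`. No continuity of `W` is assumed: injectivity of the momentum identifies the
implicit function with `W`. -/
theorem IsFinslerOn.contDiffOn_of_momentum_eq {O : Set (Model n)} {f : Model n → Model n → ℝ}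
    {W : Model n → Model n} (hf : IsFinslerOn O f) {U : Model n → ℝ} (hU : ContDiffOn ℝ ∞ U O)
    (hW0 : ∀ x ∈ O, W x ≠ 0) (hW : ∀ x ∈ O, momentum (f x) (W x) = fderiv ℝ U x) :
    ContDiffOn ℝ ∞ W O := by
  have hΩ := hf.isOpen_prod
  let T : Fin n → Model n → Model n → ℝ := fun i y w => covec f i y w - pd i U y
  have hT : ∀ i, SmoothOn (O ×ˢ {0}ᶜ) (T i) := fun i =>
    (hf.smooth_covec i).sub (smoothOn_of_contDiffOn (contDiffOn_pd hf.isOpen hU i))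
  let T' : Model n × Model n → Model n := fun q => WithLp.toLp 2 fun i => T i q.1 q.2
  have hT' : ContDiffOn ℝ ∞ T' (O ×ˢ {0}ᶜ) := by
    rw [contDiffOn_euclidean]
    exact hT
  have hzero : ∀ x ∈ O, ∀ w, w ≠ 0 → (T' (x, w) = 0 ↔ w = W x) := by
    intro x hx w hw
    constructor
    · intro h
      refine (hf.minkowski x hx).momentum_injective hw (hW0 x hx) ?_
      rw [hW x hx]
      refine clm_ext_basisVec fun i => ?_
      have h1 : T i x w = 0 := congrArg (fun z : Model n => z i) h
      rw [← covec_eq_momentum]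
      exact sub_eq_zero.1 h1
    · rintro rfl
      ext i
      change covec f i x (W x) - pd i U x = 0
      rw [covec_eq_momentum, hW x hx, pd, sub_self]
  intro x hx
  refine ContDiffAt.contDiffWithinAt ?_
  have hm : (x, W x) ∈ O ×ˢ ({0}ᶜ : Set (Model n)) := ⟨hx, hW0 x hx⟩
  have hc : ContDiffAt ℝ ∞ T' (x, W x) := hT'.contDiffAt (hΩ.mem_nhds hm)
  have hinv : (fderiv ℝ T' (x, W x) ∘L .inr ℝ (Model n) (Model n)).IsInvertible := by
    -- A kernel vector `a ≠ 0` would satisfy `g_W(a, a) = 0`.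
    refine isInvertible_of_injective ((injective_iff_map_eq_zero _).2 fun a ha => ?_)
    by_contra hne
    have hpos := (hf.minkowski x hx).halfHess_pos (W x) a (hW0 x hx) hne
    have hcomp : ∀ i, fderiv ℝ (fun w => T i x w) (W x) a = 0 := by
      intro i
      have h1 : HasFDerivAt (fun q : Model n × Model n => T i q.1 q.2) _ (x, W x) :=
        (EuclideanSpace.proj i : Model n →L[ℝ] ℝ).hasFDerivAt.comp (x, W x)
          (hc.differentiableAt (by simp)).hasFDerivAt
      rw [((hT i).hasFDerivAt_snd hΩ hm).fderiv, h1.fderiv]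
      exact congrArg (fun z : Model n => z i) ha
    have hder : ∀ i, fderiv ℝ (momentum (f x)) (W x) a (basisVec i) = 0 := by
      intro i
      rw [← (hf.minkowski x hx).halfHess_eq (hW0 x hx), halfHess_eq_fderiv_momentum, ← hcomp i]
      simp only [T, covec_eq_momentum]
      rw [fderiv_sub_const]
    have hD0 : fderiv ℝ (momentum (f x)) (W x) a = 0 := clm_ext_basisVec fun i => by
      rw [hder i]; rfl
    rw [(hf.minkowski x hx).halfHess_eq (hW0 x hx), hD0] at hpos
    exact lt_irrefl _ hpos
  have hev := hc.eventually_apply_implicitFunction (by simp) hinv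
  have hψ := hc.contDiffAt_implicitFunction (by simp) hinv
  have hself := hc.implicitFunction_apply_self (by simp) hinv
  simp only at hev hψ hself
  -- Injectivity of the momentum is available only for nonzero vectors, so the implicit function
  -- must be kept away from the zero section.
  have hne : ∀ᶠ y in nhds x, hc.implicitFunction (by simp) hinv y ≠ 0 :=
    hψ.continuousAt.eventually_ne (by rw [hself]; exact hW0 x hx)
  refine hψ.congr_of_eventuallyEq ?_
  filter_upwards [hev, hne, hf.isOpen.mem_nhds hx] with y hy hy0 hyO
  rw [(hzero x hx _ (hW0 x hx)).2 rfl] at hy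
  exact ((hzero y hyO _ hy0).1 hy).symm

end

section

/-! ### Geodesics -/

/-- Picard–Lindelöf for the first-order system `(x, v) ↦ (v, -G)`, which is `C¹` near the initial
point because `v ≠ 0`. -/
theorem IsFinslerOn.exists_geodesic {n : ℕ} {O : Set (Model n)} {f : Model n → Model n → ℝ}
    (hf : IsFinslerOn O f) {x v : Model n} (hx : x ∈ O) (hv : v ≠ 0) :
    ∃ c w : ℝ → Model n, c 0 = x ∧ w 0 = v ∧ (∀ᶠ t in nhds (0 : ℝ), HasDerivAt c (w t) t) ∧
      ∀ᶠ t in nhds (0 : ℝ), ∀ i, HasDerivAt (fun s => w s i) (-spray f i (c t) (w t)) t := by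
  let Y : Model n × Model n → Model n × Model n :=
    fun q => (q.2, WithLp.toLp 2 fun i => -spray f i q.1 q.2)
  have hY : ContDiffAt ℝ 1 Y (x, v) := by
    refine ContDiffAt.prodMk contDiffAt_snd ?_
    rw [contDiffAt_euclidean]
    intro i
    exact ((hf.smooth_spray i).contDiffAt
      (hf.isOpen_prod.mem_nhds (x := (x, v)) ⟨hx, hv⟩)).neg.of_le (by exact_mod_cast le_top)
  obtain ⟨α, hα0, ε, hε, hα⟩ :=
    hY.exists_forall_mem_closedBall_exists_eq_forall_mem_Ioo_hasDerivAt₀ 0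
  have hmem : ∀ᶠ t in nhds (0 : ℝ), HasDerivAt α (Y (α t)) t := by
    filter_upwards [Ioo_mem_nhds (show 0 - ε < 0 by linarith) (show 0 < 0 + ε by linarith)]
      with t ht using hα t ht
  refine ⟨fun t => (α t).1, fun t => (α t).2, by simp [hα0], by simp [hα0], ?_, ?_⟩
  · filter_upwards [hmem] with t ht
    exact (ContinuousLinearMap.fst ℝ (Model n) (Model n)).hasFDerivAt.comp_hasDerivAt t ht
  · filter_upwards [hmem] with t ht i
    exact ((EuclideanSpace.proj i : Model n →L[ℝ] ℝ).comp
      (ContinuousLinearMap.snd ℝ (Model n) (Model n))).hasFDerivAt.comp_hasDerivAt t ht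

namespace FinslerStructure

variable {n : ℕ} {M : Type*} [TopologicalSpace M] [ChartedSpace (Model n) M]
  [IsManifold (𝓡 n) ∞ M] (F : FinslerStructure n M)

theorem isGeodesicAt_geodesic {x : M} {v : TangentSpace (𝓡 n) x}
    (hv : vecInChart (chartAt (Model n) x) x v ≠ 0) : F.IsGeodesicAt x v (F.geodesic x v) := by
  have hne : Nonempty M := ⟨x⟩
  refine Classical.epsilon_spec (p := F.IsGeodesicAt x v) ?_
  set e := chartAt (Model n) x with he
  have hx : x ∈ e.source := mem_chart_source _ x
  obtain ⟨c, w, hc0, hw0, hc, hw⟩ := (F.isFinslerOn_inChart (chart_mem_atlas (Model n) x)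
    ).exists_geodesic (mem_chart_target (Model n) x) hv
  have hc00 : HasDerivAt c (w 0) 0 := hc.self_of_nhds
  have hct : ∀ᶠ t in nhds (0 : ℝ), c t ∈ e.target :=
    hc00.continuousAt.eventually_mem (by rw [hc0]; exact e.open_target.mem_nhds (e.map_source hx))
  have heq : ∀ᶠ t in nhds (0 : ℝ), e (e.symm (c t)) = c t := by
    filter_upwards [hct] with t ht using e.right_inv ht
  -- `IsGeodesicAt` speaks of `deriv` of the chart curve, so the curves must agree on a
  -- neighbourhood of each time `t` near `0`.
  have heq' : ∀ᶠ t in nhds (0 : ℝ), (fun s => e (e.symm (c s))) =ᶠ[nhds t] c :=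
    heq.eventually_nhds
  have hder : ∀ᶠ t in nhds (0 : ℝ), HasDerivAt (fun s => e (e.symm (c s))) (w t) t := by
    filter_upwards [heq', hc] with t h1 h2 using h2.congr_of_eventuallyEq h1
  have hderiv : ∀ᶠ t in nhds (0 : ℝ), deriv (fun s => e (e.symm (c s))) t = w t := by
    filter_upwards [hder] with t ht using ht.deriv
  refine ⟨fun t => e.symm (c t), ?_, ?_, ?_, ?_, ?_⟩
  · simp only [hc0]
    exact e.left_inv hx
  · filter_upwards [hct] with t ht using e.map_target ht
  · rw [← hw0]
    exact hder.self_of_nhds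
  · filter_upwards [hder] with t ht using ht.differentiableAt
  · filter_upwards [hderiv.eventually_nhds, heq, hw] with t h1 h2 h3 i
    have h4 : (fun s => deriv (fun r => e (e.symm (c r))) s i) =ᶠ[nhds t] fun s => w s i := by
      filter_upwards [h1] with s hs
      rw [hs]
    rw [h2, h1.self_of_nhds]
    exact (h3 i).congr_of_eventuallyEq h4

/-- The first derivative of the weight equals `weightFlow` along `η` on a whole neighbourhood of
`0`, so it can be differentiated once more by the same chain rule. The value is the same for every
geodesic with this initial velocity, and uniqueness is not needed. -/
theorem deriv_deriv_weightAlong [MeasurableSpace M] {m : MeasureTheory.Measure M} {x : M}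
    {v : TangentSpace (𝓡 n) x} {η : ℝ → M} (hη : F.IsGeodesicAt x v η)
    (hv : vecInChart (chartAt (Model n) x) x v ≠ 0)
    (hΦ : ContDiffOn ℝ ∞ (logDensity m (chartAt (Model n) x)) (chartAt (Model n) x).target) :
    deriv (deriv (F.weightAlong m x η)) 0 =
      sprayDeriv (F.inChart (chartAt (Model n) x))
        (weightFlow (F.inChart (chartAt (Model n) x)) (logDensity m (chartAt (Model n) x)))
        (chartAt (Model n) x x) (vecInChart (chartAt (Model n) x) x v) := by
  set e := chartAt (Model n) x with he
  set f := F.inChart e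
  set Φ := logDensity m e
  have hf : IsFinslerOn e.target f := F.isFinslerOn_inChart (chart_mem_atlas (Model n) x)
  set c : ℝ → Model n := fun s => e (η s) with hc
  set w : ℝ → Model n := deriv c with hw
  have hc0 : c 0 = e x := by simp only [hc, hη.start]
  have hw0 : w 0 = vecInChart e x v := hη.velocity.deriv
  have hcd : ∀ᶠ t in nhds (0 : ℝ), HasDerivAt c (w t) t := by
    filter_upwards [hη.differentiable] with t ht using ht.hasDerivAt
  have hwd : ∀ᶠ t in nhds (0 : ℝ), ∀ i, HasDerivAt (fun s => w s i) (-spray f i (c t) (w t)) t :=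
    hη.equation
  -- Continuity of the velocity follows from the geodesic equation and keeps the velocity nonzero
  -- near `0`.
  have hcont : ContinuousAt w 0 := by
    have h1 : ContinuousAt (fun s => (w s).ofLp) 0 :=
      continuousAt_pi.2 fun i => (hwd.self_of_nhds i).continuousAt
    exact (PiLp.continuous_toLp 2 fun _ : Fin n => ℝ).continuousAt.comp h1
  have hmem : ∀ᶠ t in nhds (0 : ℝ), (c t, w t) ∈ e.target ×ˢ ({0}ᶜ : Set (Model n)) := by
    have h2 : ∀ᶠ t in nhds (0 : ℝ), w t ≠ 0 := hcont.eventually_ne (by rw [hw0]; exact hv)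
    filter_upwards [hη.mem_source, h2] with t h1 h2 using ⟨e.map_source h1, h2⟩
  have hfirst : deriv (F.weightAlong m x η) =ᶠ[nhds 0] fun t => weightFlow f Φ (c t) (w t) := by
    filter_upwards [hcd, hwd, hmem] with t h1 h2 h3
    rw [← hf.sprayDeriv_weightCoord hΦ h3]
    exact (hasDerivAt_along_geodesic hf.isOpen_prod (hf.smooth_weightCoord hΦ) h3 h1 h2).deriv
  rw [hfirst.deriv_eq, ← hc0, ← hw0]
  exact (hasDerivAt_along_geodesic hf.isOpen_prod (hf.smooth_weightFlow hΦ) hmem.self_of_nhds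
    hcd.self_of_nhds hwd.self_of_nhds).deriv

end FinslerStructure

end

section

variable {n : ℕ}

/-! ### Chart independence of the divergence -/

/-- The Jacobian matrix. -/
def jacobian (τ : Model n → Model n) (x : Model n) : Matrix (Fin n) (Fin n) ℝ :=
  Matrix.of fun i j => pd j (fun y => τ y i) x

theorem jacobian_eq_toMatrix {τ : Model n → Model n} {x : Model n} (hτ : DifferentiableAt ℝ τ x) :
    jacobian τ x = LinearMap.toMatrix (EuclideanSpace.basisFun (Fin n) ℝ).toBasis
      (EuclideanSpace.basisFun (Fin n) ℝ).toBasis (fderiv ℝ τ x : Model n →ₗ[ℝ] Model n) := by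
  ext i j
  simp [jacobian, pd, fderiv_coord hτ, LinearMap.toMatrix_apply, basisVec]

theorem det_jacobian {τ : Model n → Model n} {x : Model n} (hτ : DifferentiableAt ℝ τ x) :
    (jacobian τ x).det = (fderiv ℝ τ x).det := by
  rw [jacobian_eq_toMatrix hτ, LinearMap.det_toMatrix]

theorem jacobian_mulVec {τ : Model n → Model n} {x : Model n} (hτ : DifferentiableAt ℝ τ x)
    (a : Model n) (i : Fin n) : ∑ k, jacobian τ x i k * a k = fderiv ℝ τ x a i := by
  rw [← fderiv_coord hτ, map_eq_sum_basisVec]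
  exact Finset.sum_congr rfl fun k _ => mul_comm _ _

theorem coordDiv_eq_trace (Φ : Model n → ℝ) (W : Model n → Model n) (x : Model n) :
    coordDiv Φ W x = (jacobian W x).trace + fderiv ℝ Φ x (W x) := by
  rw [coordDiv, Finset.sum_add_distrib, map_eq_sum_basisVec]
  rfl

/-- Differentiating `J W' = W ∘ τ` gives `B + J DW' = DW J`, with `B` the derivative of `J` along
`W'`. After multiplication by `J⁻¹` and taking traces, the extra term `tr(J⁻¹ B)` is the derivative
of `log |det J|` along `W'`, which is the change of the log-density. -/
theorem coordDiv_change {O : Set (Model n)} (hO : IsOpen O) {τ W W' : Model n → Model n}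
    {Φ Φ' : Model n → ℝ} (hτ : ContDiffOn ℝ ∞ τ O) (hdet : ∀ y ∈ O, (fderiv ℝ τ y).det ≠ 0)
    (hWW' : ∀ y ∈ O, fderiv ℝ τ y (W' y) = W (τ y))
    (hΦ' : ∀ y ∈ O, Φ' y = Φ (τ y) + Real.log |(fderiv ℝ τ y).det|) {x : Model n} (hx : x ∈ O)
    (hW : DifferentiableAt ℝ W (τ x)) (hW' : DifferentiableAt ℝ W' x)
    (hΦ : DifferentiableAt ℝ Φ (τ x)) :
    coordDiv Φ' W' x = coordDiv Φ W (τ x) := by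
  have hτd : ∀ y ∈ O, DifferentiableAt ℝ τ y := fun y hy =>
    (hτ.contDiffAt (hO.mem_nhds hy)).differentiableAt (by simp)
  have hτi := fun i => contDiffOn_coord hτ i
  set J := jacobian τ x with hJ
  have hJd : ∀ i k, DifferentiableAt ℝ (fun y => jacobian τ y i k) x := fun i k =>
    differentiableAt_of_contDiffOn hO hx (contDiffOn_pd hO (hτi i) k)
  have hW'i : ∀ k, DifferentiableAt ℝ (fun y => W' y k) x := fun k =>
    (EuclideanSpace.proj k : Model n →L[ℝ] ℝ).differentiableAt.comp x hW'
  let B : Matrix (Fin n) (Fin n) ℝ :=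
    Matrix.of fun i j => fderiv ℝ (fun y => jacobian τ y i j) x (W' x)
  have hJ0 : J.det ≠ 0 := by
    rw [hJ, det_jacobian (hτd x hx)]
    exact hdet x hx
  have hJu : IsUnit J.det := isUnit_iff_ne_zero.2 hJ0
  have hmat : B + J * jacobian W' x = jacobian W (τ x) * J := by
    ext i j
    have h1 : pd j (fun y => ∑ k, jacobian τ y i k * W' y k) x = pd j (fun y => W (τ y) i) x := by
      refine pd_congr hO (fun y hy => ?_) hx j
      rw [jacobian_mulVec (hτd y hy), hWW' y hy]
    have h2 : pd j (fun y => ∑ k, jacobian τ y i k * W' y k) x =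
        ∑ k, (pd j (fun y => jacobian τ y i k) x * W' x k + J i k * jacobian W' x k j) := by
      simp only [pd]
      rw [fderiv_fun_sum fun k _ => (hJd i k).fun_mul (hW'i k)]
      simp only [FunLike.coe_sum, Finset.sum_apply]
      refine Finset.sum_congr rfl fun k _ => ?_
      rw [fderiv_fun_mul (hJd i k) (hW'i k)]
      simp only [add_apply, smul_apply, smul_eq_mul, jacobian, pd, Matrix.of_apply, hJ]
      ring
    have h3 : pd j (fun y => W (τ y) i) x = (jacobian W (τ x) * J) i j := by
      have h4 : HasFDerivAt (fun y => W (τ y)) ((fderiv ℝ W (τ x)).comp (fderiv ℝ τ x)) x :=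
        hW.hasFDerivAt.comp x (hτd x hx).hasFDerivAt
      rw [pd, fderiv_coord h4.differentiableAt, h4.fderiv, ContinuousLinearMap.comp_apply,
        ← jacobian_mulVec hW, Matrix.mul_apply]
      refine Finset.sum_congr rfl fun l _ => ?_
      rw [← fderiv_coord (hτd x hx)]
      rfl
    -- Symmetry of the second derivatives of `τ` exchanges the column index of `J` with the
    -- direction of differentiation.
    have h5 : B i j = ∑ k, pd j (fun y => jacobian τ y i k) x * W' x k := by
      change fderiv ℝ (fun y => jacobian τ y i j) x (W' x) = _
      rw [map_eq_sum_basisVec]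
      refine Finset.sum_congr rfl fun k _ => ?_
      rw [mul_comm]
      congr 1
      exact pd_comm hO hx (hτi i) k j
    rw [← h3, ← h1, h2, Finset.sum_add_distrib, ← h5, Matrix.add_apply, Matrix.mul_apply]
  have htrace : (J⁻¹ * B).trace + (jacobian W' x).trace = (jacobian W (τ x)).trace := by
    have h1 := congrArg (fun A => (J⁻¹ * A).trace) hmat
    simp only [Matrix.mul_add, Matrix.trace_add] at h1
    rw [← Matrix.mul_assoc, Matrix.nonsing_inv_mul _ hJu, Matrix.one_mul,
      Matrix.trace_mul_comm J⁻¹ (jacobian W (τ x) * J), Matrix.mul_assoc,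
      Matrix.mul_nonsing_inv _ hJu, Matrix.mul_one] at h1
    exact h1
  have hlog : HasFDerivAt (fun y => Real.log (jacobian τ y).det) _ x :=
    (hasFDerivAt_det (B := jacobian τ) fun i j => (hJd i j).hasFDerivAt).log hJ0
  have hΦ'd := ((hΦ.hasFDerivAt.comp x (hτd x hx).hasFDerivAt).add hlog).congr_of_eventuallyEq
      (f₁ := Φ') (by
    filter_upwards [hO.mem_nhds hx] with y hy
    rw [hΦ' y hy, Real.log_abs, ← det_jacobian (hτd y hy)]
    rfl)
  have htr : J.det⁻¹ * ∑ i, ∑ j, J.adjugate j i * B i j = (J⁻¹ * B).trace := by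
    rw [Finset.sum_comm, Matrix.inv_def, Ring.inverse_eq_inv', Matrix.smul_mul, Matrix.trace_smul,
      smul_eq_mul]
    rfl
  rw [coordDiv_eq_trace, coordDiv_eq_trace, hΦ'd.fderiv, ← htrace, ← htr, ← hWW' x hx]
  simp only [add_apply, smul_apply, FunLike.coe_sum, Finset.sum_apply, smul_eq_mul,
    ContinuousLinearMap.comp_apply]
  change _ + (_ + J.det⁻¹ * ∑ i, ∑ j, J.adjugate j i * B i j) = _
  ring

end

/-! ### Coordinate changes between two charts -/

section

variable {n : ℕ} {M : Type*} [TopologicalSpace M]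

/-- The coordinate change from the chart `e'` to the chart `e`. -/
def transition (e e' : OpenPartialHomeomorph M (Model n)) (y : Model n) : Model n := e (e'.symm y)

/-- The domain of the coordinate change from the chart `e'` to the chart `e`. -/
def overlap (e e' : OpenPartialHomeomorph M (Model n)) : Set (Model n) :=
  e'.target ∩ e'.symm ⁻¹' e.source

section Transition

variable {e e' : OpenPartialHomeomorph M (Model n)} {y : Model n}

theorem isOpen_overlap (e e' : OpenPartialHomeomorph M (Model n)) : IsOpen (overlap e e') :=
  e'.symm.isOpen_inter_preimage e.open_source

theorem transition_mem_overlap (hy : y ∈ overlap e e') : transition e e' y ∈ overlap e' e := by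
  refine ⟨e.map_source hy.2, ?_⟩
  rw [Set.mem_preimage, transition, e.left_inv hy.2]
  exact e'.map_target hy.1

theorem symm_transition (hy : y ∈ overlap e e') : e.symm (transition e e' y) = e'.symm y :=
  e.left_inv hy.2

theorem transition_transition (hy : y ∈ overlap e e') :
    transition e' e (transition e e' y) = y := by
  rw [transition, symm_transition hy, e'.right_inv hy.1]

variable [ChartedSpace (Model n) M] [IsManifold (𝓡 n) ∞ M]

theorem contDiffOn_transition (he : e ∈ atlas (Model n) M) (he' : e' ∈ atlas (Model n) M) :
    ContDiffOn ℝ ∞ (transition e e') (overlap e e') := by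
  have h1 : ContMDiffOn (𝓡 n) (𝓡 n) ∞ e'.symm e'.target :=
    contMDiffOn_symm_of_mem_maximalAtlas (IsManifold.subset_maximalAtlas he')
  have h2 : ContMDiffOn (𝓡 n) (𝓡 n) ∞ e e.source :=
    contMDiffOn_of_mem_maximalAtlas (IsManifold.subset_maximalAtlas he)
  exact (h2.comp (h1.mono Set.inter_subset_left) fun y hy => hy.2).contDiffOn

theorem differentiableAt_transition (he : e ∈ atlas (Model n) M) (he' : e' ∈ atlas (Model n) M)
    (hy : y ∈ overlap e e') : DifferentiableAt ℝ (transition e e') y :=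
  ((contDiffOn_transition he he').contDiffAt ((isOpen_overlap e e').mem_nhds hy)).differentiableAt
    (by simp)

theorem fderiv_transition (he : e ∈ atlas (Model n) M) (he' : e' ∈ atlas (Model n) M)
    (hy : y ∈ overlap e e') (a : Model n) :
    fderiv ℝ (transition e e') y a = toChart e (e'.symm y) (chartDeriv he' hy.1 a) := by
  have h1 := (mdifferentiable_of_mem_atlas_model he').mdifferentiableAt_symm hy.1
  have h2 := (mdifferentiable_of_mem_atlas_model he).mdifferentiableAt hy.2
  rw [← mfderiv_eq_fderiv]
  have h3 := mfderiv_comp y h2 h1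
  exact congrArg (fun l => l a) h3

theorem fderiv_transition_comp (he : e ∈ atlas (Model n) M) (he' : e' ∈ atlas (Model n) M)
    (hy : y ∈ overlap e e') :
    (fderiv ℝ (transition e' e) (transition e e' y)).comp (fderiv ℝ (transition e e') y) =
      ContinuousLinearMap.id ℝ (Model n) := by
  have h1 := (differentiableAt_transition he' he (transition_mem_overlap hy)).hasFDerivAt.comp y
    (differentiableAt_transition he he' hy).hasFDerivAt
  refine (h1.congr_of_eventuallyEq (f₁ := id) ?_).unique (hasFDerivAt_id y)
  filter_upwards [(isOpen_overlap e e').mem_nhds hy] with z hz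
  exact (transition_transition hz).symm

theorem det_fderiv_transition_ne_zero (he : e ∈ atlas (Model n) M) (he' : e' ∈ atlas (Model n) M)
    (hy : y ∈ overlap e e') : (fderiv ℝ (transition e e') y).det ≠ 0 := by
  have h1 := congrArg ContinuousLinearMap.det (fderiv_transition_comp he he' hy)
  intro h0
  have h2 : (fderiv ℝ (transition e' e) (transition e e' y)).det *
      (fderiv ℝ (transition e e') y).det = 1 := by
    have h3 := LinearMap.det_comp
      (fderiv ℝ (transition e' e) (transition e e' y) : Model n →ₗ[ℝ] Model n)
      (fderiv ℝ (transition e e') y : Model n →ₗ[ℝ] Model n)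
    refine h3.symm.trans (Eq.trans ?_ (LinearMap.det_id (M := Model n) (A := ℝ)))
    exact h1
  rw [h0, mul_zero] at h2
  exact zero_ne_one h2

theorem fderiv_transition_field (he : e ∈ atlas (Model n) M) (he' : e' ∈ atlas (Model n) M)
    (hy : y ∈ overlap e e') (V : M → Model n) :
    fderiv ℝ (transition e e') y (toChart e' (e'.symm y) (V (e'.symm y))) =
      toChart e (e.symm (transition e e' y)) (V (e.symm (transition e e' y))) := by
  rw [fderiv_transition he he' hy, ← chartDeriv_symm_apply he' hy.1,
    ContinuousLinearEquiv.apply_symm_apply, symm_transition hy]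

end Transition

/-! ### The density in two charts -/

section Density

variable [MeasurableSpace M] {e e' : OpenPartialHomeomorph M (Model n)}
  {m : MeasureTheory.Measure M}

theorem isLogDensity_logDensity [ChartedSpace (Model n) M] (hm : IsSmoothPositiveMeasure n m)
    (he : e ∈ atlas (Model n) M) : IsLogDensity m e (logDensity m e) :=
  Classical.epsilon_spec (hm e he)

variable [BorelSpace M]

/-- The image is the preimage of `T` under the continuous restriction of `e` to its open source. -/
theorem measurableSet_symm_image (e : OpenPartialHomeomorph M (Model n)) {T : Set (Model n)}
    (hT : MeasurableSet T) (hTe : T ⊆ e.target) : MeasurableSet (e.symm '' T) := by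
  have h1 : e.symm '' T = Subtype.val '' ((e.source.domRestrict e) ⁻¹' T) := by
    ext z
    constructor
    · rintro ⟨y, hy, rfl⟩
      exact ⟨⟨e.symm y, e.map_target (hTe hy)⟩, by
        simpa [Set.domRestrict_apply, e.right_inv (hTe hy)] using hy, rfl⟩
    · rintro ⟨⟨z, hz⟩, hzT, rfl⟩
      exact ⟨e z, hzT, e.left_inv hz⟩
  rw [h1]
  exact e.open_source.measurableSet.subtype_image
    (e.continuousOn.domRestrict.measurable hT)

variable [ChartedSpace (Model n) M] [IsManifold (𝓡 n) ∞ M]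

/-- The densities are chosen separately in each chart, so they can only be compared through the
measure: the change of variables formula equates their integrals over all measurable subsets of the
overlap, hence they agree almost everywhere, and everywhere by continuity. -/
theorem logDensity_change (hm : IsSmoothPositiveMeasure n m) (he : e ∈ atlas (Model n) M)
    (he' : e' ∈ atlas (Model n) M) {y : Model n} (hy : y ∈ overlap e e') :
    logDensity m e' y = logDensity m e (transition e e' y) +
      Real.log |(fderiv ℝ (transition e e') y).det| := by
  obtain ⟨hΦ, hmΦ⟩ := isLogDensity_logDensity hm he
  obtain ⟨hΦ', hmΦ'⟩ := isLogDensity_logDensity hm he'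
  set Φ := logDensity m e
  set Φ' := logDensity m e'
  set τ := transition e e' with hτ
  set O := overlap e e' with hO
  have hOo : IsOpen O := isOpen_overlap e e'
  have hτc : ContDiffOn ℝ ∞ τ O := contDiffOn_transition he he'
  have hτm : ∀ y ∈ O, τ y ∈ e.target := fun y hy => e.map_source hy.2
  have hdc : ContinuousOn (fun y => (fderiv ℝ τ y).det) O :=
    ContinuousLinearMap.continuous_det.comp_continuousOn
      (hτc.continuousOn_fderiv_of_isOpen hOo (by simp))
  have hc1 : ContinuousOn (fun y => Real.exp (Φ' y)) O :=
    Real.continuous_exp.comp_continuousOn (hΦ'.continuousOn.mono Set.inter_subset_left)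
  have hc2 : ContinuousOn (fun y => |(fderiv ℝ τ y).det| * Real.exp (Φ (τ y))) O :=
    hdc.abs.mul (Real.continuous_exp.comp_continuousOn
      (hΦ.continuousOn.comp hτc.continuousOn hτm))
  have hkey : ∀ T : Set (Model n), MeasurableSet T → T ⊆ O →
      ∫⁻ y in T, ENNReal.ofReal (Real.exp (Φ' y)) =
        ∫⁻ y in T, ENNReal.ofReal (|(fderiv ℝ τ y).det| * Real.exp (Φ (τ y))) := by
    intro T hT hTO
    have hTe : T ⊆ e'.target := fun y hy => (hTO hy).1
    have hs := measurableSet_symm_image e' hT hTe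
    have himg' : e' '' (e'.symm '' T) = T := by
      rw [Set.image_image]
      refine (Set.image_congr fun y hy => e'.right_inv (hTe hy)).trans (Set.image_id' T)
    have himg : e '' (e'.symm '' T) = τ '' T := by rw [Set.image_image]; rfl
    have h1 := hmΦ' _ hs (by rintro _ ⟨y, hy, rfl⟩; exact e'.map_target (hTe hy))
    have h2 := hmΦ _ hs (by rintro _ ⟨y, hy, rfl⟩; exact (hTO hy).2)
    rw [himg'] at h1
    rw [himg, MeasureTheory.lintegral_image_eq_lintegral_abs_det_fderiv_mul _ hT
      (fun y hy => (differentiableAt_transition he he' (hTO hy)).hasFDerivAt.hasFDerivWithinAt)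
      (fun y hy z hz h => by
        rw [← transition_transition (hTO hy), ← transition_transition (hTO hz)]
        exact congrArg _ h)] at h2
    rw [← h1, h2]
    refine MeasureTheory.setLIntegral_congr_fun hT fun y _ => ?_
    rw [ENNReal.ofReal_mul (abs_nonneg _)]
  have hae : (fun y => ENNReal.ofReal (Real.exp (Φ' y))) =ᵐ[MeasureTheory.volume.restrict O]
      fun y => ENNReal.ofReal (|(fderiv ℝ τ y).det| * Real.exp (Φ (τ y))) := by
    refine MeasureTheory.ae_eq_of_forall_setLIntegral_eq_of_sigmaFinite₀
      (hc1.aemeasurable hOo.measurableSet).ennreal_ofReal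
      (hc2.aemeasurable hOo.measurableSet).ennreal_ofReal fun s hs _ => ?_
    rw [MeasureTheory.Measure.restrict_restrict hs]
    exact hkey _ (hs.inter hOo.measurableSet) Set.inter_subset_right
  have heq := MeasureTheory.Measure.eqOn_open_of_ae_eq hae hOo
    (ENNReal.continuous_ofReal.comp_continuousOn hc1)
    (ENNReal.continuous_ofReal.comp_continuousOn hc2) hy
  have hd := det_fderiv_transition_ne_zero he he' hy
  have hexp : Real.exp (Φ' y) = |(fderiv ℝ τ y).det| * Real.exp (Φ (τ y)) :=
    (ENNReal.ofReal_eq_ofReal_iff (Real.exp_pos _).le (by positivity)).1 heq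
  rw [← Real.log_exp (Φ' y), hexp, Real.log_mul (abs_ne_zero.2 hd) (Real.exp_ne_zero _),
    Real.log_exp, add_comm]

/-- The divergence may be computed in any chart. -/
theorem divergence_eq_coordDiv (hm : IsSmoothPositiveMeasure n m) (he : e ∈ atlas (Model n) M)
    (V : M → Model n) {z : M} (hz : z ∈ e.source)
    (hV : ContDiffAt ℝ ∞ (fun y => toChart e (e.symm y) (V (e.symm y))) (e z)) :
    divergence m V z =
      coordDiv (logDensity m e) (fun y => toChart e (e.symm y) (V (e.symm y))) (e z) := by
  set e' := chartAt (Model n) z with he'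
  have he'a : e' ∈ atlas (Model n) M := chart_mem_atlas _ z
  have hz' : z ∈ e'.source := mem_chart_source _ z
  have hy : e' z ∈ overlap e e' := ⟨e'.map_source hz', by simpa [e'.left_inv hz'] using hz⟩
  have hτ : transition e e' (e' z) = e z := by rw [transition, e'.left_inv hz']
  have hΦ := (isLogDensity_logDensity hm he).1
  change coordDiv (logDensity m e') (fun y => toChart e' (e'.symm y) (V (e'.symm y))) (e' z) = _
  rw [← hτ] at hV ⊢
  refine coordDiv_change (isOpen_overlap e e') (contDiffOn_transition he he'a)
    (fun y hy => det_fderiv_transition_ne_zero he he'a hy)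
    (fun y hy => fderiv_transition_field he he'a hy V)
    (fun y hy => logDensity_change hm he he'a hy) hy (hV.differentiableAt (by simp)) ?_
    ((hΦ.contDiffAt (e.open_target.mem_nhds (e.map_source hy.2))).differentiableAt (by simp))
  -- Differentiability of the field in the preferred chart is not assumed: there it is the
  -- differential of the coordinate change applied to the smooth expression in `e`.
  have hd1 : DifferentiableAt ℝ
      (fun y => fderiv ℝ (transition e' e) (transition e e' y)) (e' z) := by
    have h1 : ContDiffOn ℝ ∞ (fderiv ℝ (transition e' e)) (overlap e' e) :=
      (contDiffOn_transition he'a he).fderiv_of_isOpen (isOpen_overlap e' e) (by simp)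
    exact ((h1.contDiffAt ((isOpen_overlap e' e).mem_nhds
      (transition_mem_overlap hy))).differentiableAt (by simp)).comp _
      (differentiableAt_transition he he'a hy)
  have hd2 := (hV.differentiableAt (by simp)).comp _ (differentiableAt_transition he he'a hy)
  refine (hd1.clm_apply hd2).congr_of_eventuallyEq ?_
  filter_upwards [(isOpen_overlap e e').mem_nhds hy] with y hy
  have := fderiv_transition_field he'a he (transition_mem_overlap hy) V
  rw [transition_transition hy] at this
  exact this.symm

end Density

end

section

/-! ### The improved Bochner inequality -/

theorem coordDiv_congr {n : ℕ} {O : Set (Model n)} (hO : IsOpen O) {Φ : Model n → ℝ}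
    {W W' : Model n → Model n} (h : ∀ y ∈ O, W y = W' y) {x : Model n} (hx : x ∈ O) :
    coordDiv Φ W x = coordDiv Φ W' x := by
  refine Finset.sum_congr rfl fun i _ => ?_
  rw [pd_congr hO (fun y hy => by rw [h y hy]) hx i (ψ := fun y => W' y i), h x hx]

/-- The improvement of the Bochner inequality: the norm of the gradient of the norm of a gradient
vector field is dominated by the Hilbert–Schmidt norm of the Hessian. -/
theorem IsFinslerOn.fderiv_norm_le_trace {n : ℕ} {O : Set (Model n)} {f : Model n → Model n → ℝ}
    {W : Model n → Model n} (hf : IsFinslerOn O f) (hW : ContDiffOn ℝ ∞ W O)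
    (hW0 : ∀ x ∈ O, W x ≠ 0) {U : Model n → ℝ} (hU : ContDiffOn ℝ ∞ U O)
    (hUW : ∀ x ∈ O, ∀ i, covec f i x (W x) = pd i U x) {x : Model n} (hx : x ∈ O) {Y : Model n}
    (hY : ∀ b, halfHess (f x) (W x) Y b = fderiv ℝ (fun y => f y (W y)) x b) :
    fderiv ℝ (fun y => f y (W y)) x Y ≤ (covDeriv f W x * covDeriv f W x).trace := by
  have hmk := hf.minkowski x hx
  have hv := hW0 x hx
  have hs : 0 < f x (W x) := hmk.pos hv
  have hd : DifferentiableAt ℝ (fun y => f y (W y)) x :=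
    differentiableAt_of_contDiffOn hf.isOpen hx
      (contDiffOn_comp_field hf.smooth hW fun y hy => ⟨hy, hW0 y hy⟩)
  have hE : HasFDerivAt (fun y => energy f y (W y))
      (f x (W x) • fderiv ℝ (fun y => f y (W y)) x) x := by
    refine ((hd.hasFDerivAt.pow 2).const_mul (1 / 2 : ℝ)).congr_fderiv ?_
    rw [smul_smul]
    congr 1
    simp
  -- Both sides represent `d(F²/2) = F dF` with respect to the nondegenerate `g`.
  have hacc : accel f W x = f x (W x) • Y := by
    refine hmk.eq_of_halfHess_eq hv fun b => ?_
    rw [hf.halfHess_accel hW hW0 hU hUW hx, hE.fderiv, hmk.halfHess_eq hv, map_smul, smul_apply,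
      smul_apply, ← hmk.halfHess_eq hv, hY]
  have hYY : halfHess (f x) (W x) (accel f W x) (accel f W x) =
      f x (W x) ^ 2 * halfHess (f x) (W x) Y Y := by
    rw [hacc, hmk.halfHess_eq hv, hmk.halfHess_eq hv, map_smul, map_smul, smul_apply, smul_eq_mul,
      smul_eq_mul]
    ring
  have hWW : halfHess (f x) (W x) (W x) (W x) = f x (W x) ^ 2 := by
    rw [hmk.halfHess_self_left hv, hmk.momentum_self hv]
  have key := mulVec_form_le_trace (hmk.gMatrix_posDef hv)
    (hf.gMatrix_mul_covDeriv_symm hW hW0 hU hUW hx) (W x).ofLp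
  rw [← hmk.halfHess_eq_dotProduct hv (W x) (W x), hWW] at key
  have h1 := hmk.halfHess_eq_dotProduct hv (accel f W x) (accel f W x)
  rw [hYY] at h1
  rw [← hY Y]
  -- After multiplication by `F²` this is `g(AW, AW) ≤ tr(A²) g(W, W)`, because `AW = F Y` and `g(W,
  -- W) = F²`.
  refine le_of_mul_le_mul_left ?_ (pow_pos hs 2)
  rw [h1, mul_comm (f x (W x) ^ 2)]
  exact key

namespace FinslerStructure

variable {n : ℕ} {M : Type*} [TopologicalSpace M] [ChartedSpace (Model n) M]
  [IsManifold (𝓡 n) ∞ M] [MeasurableSpace M] [BorelSpace M]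

/-- The improved Bochner inequality, with tangent spaces identified with `ℝⁿ`. -/
theorem bochner (F : FinslerStructure n M) {m : MeasureTheory.Measure M}
    (hm : IsSmoothPositiveMeasure n m) {K : ℝ} (hK : F.RicciInftyGE m K) {u : M → ℝ}
    (hu : ContMDiff (𝓡 n) 𝓘(ℝ, ℝ) ∞ u) {x : M} (hx : dform (n := n) u x ≠ 0) :
    dform (fun z => F.fibreNorm z (F.grad u z)) x
        (F.linGrad u (fun z => F.fibreNorm z (F.grad u z)) x)
      ≤ divergence m (F.linGrad u fun z => F.fibreNorm z (F.grad u z) ^ 2 / 2) x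
        - dform (F.laplacian m u) x (F.grad u x) - K * F.fibreNorm x (F.grad u x) ^ 2 := by
  have he : chartAt (Model n) x ∈ atlas (Model n) M := chart_mem_atlas _ x
  have hxs : x ∈ (chartAt (Model n) x).source := mem_chart_source _ x
  have hΦ := (isLogDensity_logDensity hm he).1
  have hft := F.isFinslerOn_inChart he
  set e := chartAt (Model n) x with hedef
  set f := F.inChart e with hfdef
  set Φ := logDensity m e with hΦdef
  set W := F.gradInChart e u with hWdef
  have hxe : e.symm (e x) = x := e.left_inv hxs
  have hy0 : e x ∈ e.target := e.map_source hxs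
  have hUt : ContDiffOn ℝ ∞ (u ∘ e.symm) e.target := contDiffOn_comp_symm he hu
  have hUd : ∀ y ∈ e.target, DifferentiableAt ℝ (u ∘ e.symm) y := fun y hy =>
    differentiableAt_of_contDiffOn e.open_target hy hUt
  let O : Set (Model n) := e.target ∩ (fderiv ℝ (u ∘ e.symm)) ⁻¹' {0}ᶜ
  have hO : IsOpen O := (hUt.continuousOn_fderiv_of_isOpen e.open_target
    (by simp)).isOpen_inter_preimage e.open_target isOpen_compl_singleton
  have hOt : O ⊆ e.target := Set.inter_subset_left
  have hxO : e x ∈ O := by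
    refine ⟨hy0, fun h0 => hx (ContinuousLinearMap.ext fun a => ?_)⟩
    have h1 := dform_eq he hy0 (hUd _ hy0) a
    rw [Set.mem_singleton_iff.1 h0, hxe] at h1
    exact h1
  have hf : IsFinslerOn O f := hft.mono hO hOt
  have hU := hUt.mono hOt
  have hspec : ∀ y ∈ O, W y ≠ 0 ∧ momentum (f y) (W y) = fderiv ℝ (u ∘ e.symm) y := fun y hy =>
    F.gradInChart_spec he (hOt hy) (hUd y (hOt hy)) hy.2
  have hW0 : ∀ y ∈ O, W y ≠ 0 := fun y hy => (hspec y hy).1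
  have hW : ContDiffOn ℝ ∞ W O :=
    hf.contDiffOn_of_momentum_eq hU hW0 fun y hy => (hspec y hy).2
  have hUW : ∀ y ∈ O, ∀ i, covec f i y (W y) = pd i (u ∘ e.symm) y := fun y hy i => by
    rw [covec_eq_momentum, (hspec y hy).2, pd]
  have hWx : W (e x) = toChart e x (F.grad u x) := by
    rw [hWdef, gradInChart, hxe]
  have hnorm : ∀ y ∈ e.target, F.fibreNorm (e.symm y) (F.grad u (e.symm y)) = f y (W y) :=
    fun y hy => (F.inChart_gradInChart he hy u).symm
  -- the norm of the gradient
  set φ : M → ℝ := fun z => F.fibreNorm z (F.grad u z) with hφdef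
  have hφeq : ∀ y ∈ O, (φ ∘ e.symm) =ᶠ[nhds y] fun y => f y (W y) := fun y hy => by
    filter_upwards [e.open_target.mem_nhds (hOt hy)] with z hz using hnorm z hz
  have hφd : ∀ y ∈ O, DifferentiableAt ℝ (φ ∘ e.symm) y := fun y hy =>
    (differentiableAt_of_contDiffOn hO hy (contDiffOn_comp_field hf.smooth hW
      fun y hy => ⟨hy, hW0 y hy⟩)).congr_of_eventuallyEq (hφeq y hy)
  have hleft : dform φ x (F.linGrad u φ x) ≤ (covDeriv f W (e x) * covDeriv f W (e x)).trace := by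
    have h1 := dform_eq he hy0 (hφd _ hxO) (F.linGrad u φ (e.symm (e x)))
    rw [(hφeq _ hxO).fderiv_eq] at h1
    rw [hxe] at h1
    rw [h1]
    refine hf.fderiv_norm_le_trace hW hW0 hU hUW hxO fun b => ?_
    have h2 := F.halfHess_linGrad_inChart he hy0 (hW0 _ hxO) (hφd _ hxO) b
    rw [(hφeq _ hxO).fderiv_eq, hxe] at h2
    exact h2
  -- the energy of the gradient
  set ψ : M → ℝ := fun z => F.fibreNorm z (F.grad u z) ^ 2 / 2 with hψdef
  have hψeq : ∀ y ∈ O, (ψ ∘ e.symm) =ᶠ[nhds y] fun y => energy f y (W y) := fun y hy => by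
    filter_upwards [e.open_target.mem_nhds (hOt hy)] with z hz
    change F.fibreNorm (e.symm z) (F.grad u (e.symm z)) ^ 2 / 2 = energy f z (W z)
    rw [hnorm z hz, energy]
    ring
  have hψd : ∀ y ∈ O, DifferentiableAt ℝ (ψ ∘ e.symm) y := fun y hy =>
    (differentiableAt_of_contDiffOn hO hy (contDiffOn_comp_field hf.smooth_energy hW
      fun y hy => ⟨hy, hW0 y hy⟩)).congr_of_eventuallyEq (hψeq y hy)
  -- At `x` itself the preferred chart is `e`, so no change of chart is needed; it suffices to
  -- identify the field with the acceleration on `O`.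
  have hlin : divergence m (F.linGrad u ψ) x = coordDiv Φ (accel f W) (e x) := by
    refine coordDiv_congr (W := fun y => toChart e (e.symm y) (F.linGrad u ψ (e.symm y))) hO
      (fun y hy => ?_) hxO
    refine (hf.minkowski y hy).eq_of_halfHess_eq (hW0 y hy) fun b => ?_
    rw [hf.halfHess_accel hW hW0 hU hUW hy, ← (hψeq y hy).fderiv_eq]
    exact F.halfHess_linGrad_inChart he (hOt hy) (hW0 y hy) (hψd y hy) b
  -- the Laplacian
  have hlap : ∀ y ∈ O, F.laplacian m u (e.symm y) = coordDiv Φ W y := fun y hy => by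
    have hey : e (e.symm y) = y := e.right_inv (hOt hy)
    have h1 := divergence_eq_coordDiv hm he (F.grad u) (e.map_target (hOt hy)) (by
      rw [hey]
      exact hW.contDiffAt (hO.mem_nhds hy))
    rw [hey] at h1
    exact h1
  have hlapeq : (F.laplacian m u ∘ e.symm) =ᶠ[nhds (e x)] coordDiv Φ W := by
    filter_upwards [hO.mem_nhds hxO] with y hy using hlap y hy
  have hlapd : DifferentiableAt ℝ (F.laplacian m u ∘ e.symm) (e x) :=
    (differentiableAt_of_contDiffOn hO hxO (IsFinslerOn.contDiffOn_coordDiv hO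
      (hΦ.mono hOt) hW)).congr_of_eventuallyEq hlapeq
  have hdlap : dform (F.laplacian m u) x (F.grad u x) =
      fderiv ℝ (coordDiv Φ W) (e x) (W (e x)) := by
    have h1 := dform_eq he hy0 hlapd (F.grad u (e.symm (e x)))
    rw [hlapeq.fderiv_eq, hxe, ← hWx] at h1
    exact h1
  -- the curvature
  have hvne : vecInChart e x (F.gradient u x) ≠ 0 := fun h => hW0 _ hxO (hWx.trans h)
  have hric : K * F.fibreNorm x (F.grad u x) ^ 2 ≤
      ricciCoord f (e x) (W (e x)) + sprayDeriv f (weightFlow f Φ) (e x) (W (e x)) := by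
    have h1 := hK x (F.gradient u x)
    have hg0 : F.gradient u x ≠ 0 := (F.grad_spec hx).1
    rw [ricciInfty, if_neg hg0,
      F.deriv_deriv_weightAlong (F.isGeodesicAt_geodesic hvne) hvne hΦ] at h1
    rw [hWx]
    exact h1
  have hmain := hf.coordDiv_accel_sub (hΦ.mono hOt) hW hW0 hxO
  rw [hlin, hdlap]
  linarith

end FinslerStructure

end

end Finsler

end

theorem mainTheorem4 {n : ℕ} (hn : 2 ≤ n) {M : Type*} [TopologicalSpace M] [T2Space M]
    [SecondCountableTopology M] [ConnectedSpace M] [ChartedSpace (Finsler.Model n) M]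
    [IsManifold (𝓡 n) ∞ M] [MeasurableSpace M] [BorelSpace M]
    (F : Finsler.FinslerStructure n M) (m : MeasureTheory.Measure M)
    (hm : Finsler.IsSmoothPositiveMeasure n m)
    (K : ℝ) (hK : F.RicciInftyGE m K)
    (u : M → ℝ) (hu : ContMDiff (𝓡 n) 𝓘(ℝ, ℝ) ∞ u)
    (x : M) (hx : Finsler.differential (n := n) u x ≠ 0) :
    Finsler.differential (n := n) (fun y => F.toFun y (F.gradient u y)) x
        (F.linGradient (F.gradient u) (fun y => F.toFun y (F.gradient u y)) x)
      ≤ F.linLaplacian m (F.gradient u) (fun y => F.toFun y (F.gradient u y) ^ 2 / 2) x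
        - Finsler.differential (n := n) (F.laplacian m u) x (F.gradient u x)
        - K * F.toFun x (F.gradient u x) ^ 2 :=
  F.bochner hm hK hu hx
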